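/- Let $X$ be a nonsingular algebraic variety over an algebraically closed field $k$ of characteristic $0$, let $D\subset X$ be a reduced effective divisor, and let $i\colon D\to X$ be the inclusion. Let $D^s$ be the singular subscheme of $D$: its ideal sheaf $\tilde{\mathscr I}\subseteq\mathscr O_X$ (the Jacobian ideal of $D$) is generated, where $h$ is a local equation of $D$, by $h$ and all derivatives $\theta h$ of $h$ along $k$-derivations $\theta$ of $\mathscr O_X$; let $\mathscr I=\tilde{\mathscr I}\,\mathscr O_D$ be the ideal sheaf of $D^s$ in $\mathscr O_D$. Suppose that $\tilde{\mathscr I}$ is of linear type, i.e. that the canonical epimorphism $\mathrm{Sym}_{\mathscr O_X}(\tilde{\mathscr I})\to\mathrm{Rees}_{\mathscr O_X}(\tilde{\mathscr I})=\bigoplus_{n\ge 0}\tilde{\mathscr I}^{\,n}$ is an isomorphism. Then there is an isomorphism of schemes over $X$ $$\mathrm{Proj}\big(\mathrm{Sym}_{\mathscr O_X}(i_*\mathscr I)\big)\;\cong\;\mathrm{qBl}_{D^s}D .$$ Here, for a closed subscheme $W$ of a $k$-scheme $V$, the quasi-symmetric blow-up $\mathrm{qBl}_WV$ is $\mathrm{Proj}$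 of the quasi-symmetric blow-up algebra, the quasi-coherent graded $\mathscr O_V$-algebra whose sections over an affine open subset $\mathrm{Spec}\,A\subseteq V$, in which $W$ is defined by the ideal $I\subseteq A$, form the inverse limit, over all surjections of $k$-algebras $R\to A$ (that is, over all closed embeddings of $\mathrm{Spec}\,A$ in an affine ambient $k$-scheme $\mathrm{Spec}\,R$, possibly singular) and all homomorphisms of $k$-algebras compatible with these surjections, of the blow-up algebras $$A\oplus\bigoplus_{n\ge1}J^n/KJ^{n-1},\qquad K=\ker(R\to A),\quad J=\text{the preimage of } I \text{ in } R .$$ -/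

import Mathlib

universe u

open CategoryTheory Limits AlgebraicGeometry

noncomputable section

namespace QuasiBlowup

section SymmetricAlgebra

open scoped DirectSum

variable {A A' A'' M M' M'' : Type*} [CommRing A] [CommRing A'] [CommRing A'']
  [AddCommMonoid M] [AddCommMonoid M'] [AddCommMonoid M''] [Module A M] [Module A' M']
  [Module A'' M'']

variable (A M) in
/-- The degree `n` part of the symmetric algebra: the span of the `n`-fold products of elements
of the module. -/
def symGrading (n : ℕ) : Submodule A (SymmetricAlgebra A M) :=
  LinearMap.range (SymmetricAlgebra.ι A M) ^ n

instance : SetLike.GradedMonoid (symGrading A M) :=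
  inferInstanceAs (SetLike.GradedMonoid
    ((LinearMap.range (SymmetricAlgebra.ι A M) ^ ·) : ℕ → Submodule A _))

lemma ι_mem_symGrading (m : M) : SymmetricAlgebra.ι A M m ∈ symGrading A M 1 := by
  simp [symGrading]

lemma algebraMap_mem_symGrading (a : A) :
    algebraMap A (SymmetricAlgebra A M) a ∈ symGrading A M 0 := by
  simp only [symGrading, pow_zero]
  exact Submodule.algebraMap_mem a

variable (A M) in
def symGradedι : M →ₗ[A] ⨁ i : ℕ, symGrading A M i :=
  DirectSum.lof A ℕ (fun i => symGrading A M i) 1 ∘ₗ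
    (SymmetricAlgebra.ι A M).codRestrict _ fun m => ι_mem_symGrading m

instance symGradedAlgebra : GradedAlgebra (symGrading A M) :=
  GradedAlgebra.ofAlgHom _ (SymmetricAlgebra.lift (symGradedι A M))
    (by
      ext m
      change DirectSum.coeAlgHom (symGrading A M)
        (SymmetricAlgebra.lift (symGradedι A M) (SymmetricAlgebra.ι A M m)) = _
      rw [SymmetricAlgebra.lift_ι_apply]
      exact DirectSum.coeAlgHom_of _ _ _)
    fun i x => by
      obtain ⟨x, hx⟩ := x
      dsimp only
      induction hx using Submodule.pow_induction_on_left' with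
      | algebraMap r => rw [AlgHom.commutes, DirectSum.algebraMap_apply]; rfl
      | add x y i hx hy ihx ihy => rw [map_add, ihx, ihy, ← map_add]; rfl
      | mem_mul m hm i x hx ih =>
        obtain ⟨m, rfl⟩ := hm
        rw [map_mul, ih, SymmetricAlgebra.lift_ι_apply]
        simp only [symGradedι, LinearMap.comp_apply, DirectSum.lof_eq_of]
        erw [DirectSum.of_mul_of]
        exact DirectSum.of_eq_of_gradedMonoid_eq (Sigma.subtype_ext (add_comm _ _) rfl)

lemma sym_ringHom_ext {B : Type*} [CommRing B] {f g : SymmetricAlgebra A M →+* B}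
    (h₀ : ∀ a, f (algebraMap A _ a) = g (algebraMap A _ a))
    (h₁ : ∀ m, f (SymmetricAlgebra.ι A M m) = g (SymmetricAlgebra.ι A M m)) : f = g := by
  refine RingHom.ext fun x => ?_
  induction x using SymmetricAlgebra.induction with
  | algebraMap r => exact h₀ r
  | ι x => exact h₁ x
  | mul a b ha hb => rw [map_mul, map_mul, ha, hb]
  | add a b ha hb => rw [map_add, map_add, ha, hb]

/-- The ring homomorphism out of a symmetric algebra determined by a ring homomorphism on the
scalars and a compatible additive map on the module. -/
def symLift {B : Type*} [CommRing B] (ρ : A →+* B) (g : M →+ B)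
    (hg : ∀ a m, g (a • m) = ρ a * g m) : SymmetricAlgebra A M →+* B :=
  letI := ρ.toAlgebra
  (SymmetricAlgebra.lift (A := B)
    { toFun := g, map_add' := map_add g, map_smul' := hg } : SymmetricAlgebra A M →ₐ[A] B).toRingHom

section
variable {B : Type*} [CommRing B] (ρ : A →+* B) (g : M →+ B)
    (hg : ∀ a m, g (a • m) = ρ a * g m)

@[simp] lemma symLift_algebraMap (a : A) : symLift ρ g hg (algebraMap A _ a) = ρ a := by
  letI := ρ.toAlgebra
  exact AlgHom.commutes (SymmetricAlgebra.lift (A := B)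
    { toFun := g, map_add' := map_add g, map_smul' := hg } : SymmetricAlgebra A M →ₐ[A] B) a

@[simp] lemma symLift_ι (m : M) : symLift ρ g hg (SymmetricAlgebra.ι A M m) = g m := by
  letI := ρ.toAlgebra
  exact SymmetricAlgebra.lift_ι_apply (A := B)
    { toFun := g, map_add' := map_add g, map_smul' := hg } m

end

/-- Functoriality of the symmetric algebra for semilinear maps. -/
def symMap (ρ : A →+* A') (g : M →ₛₗ[ρ] M') : SymmetricAlgebra A M →+* SymmetricAlgebra A' M' :=
  symLift ((algebraMap A' _).comp ρ) ((SymmetricAlgebra.ι A' M').toAddMonoidHom.comp g.toAddMonoidHom)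
    (by intro a m; simp [Algebra.smul_def])

@[simp] lemma symMap_algebraMap (ρ : A →+* A') (g : M →ₛₗ[ρ] M') (a : A) :
    symMap ρ g (algebraMap A _ a) = algebraMap A' _ (ρ a) :=
  symLift_algebraMap _ _ _ a

@[simp] lemma symMap_ι (ρ : A →+* A') (g : M →ₛₗ[ρ] M') (m : M) :
    symMap ρ g (SymmetricAlgebra.ι A M m) = SymmetricAlgebra.ι A' M' (g m) :=
  symLift_ι _ _ _ m

lemma symMap_mem (ρ : A →+* A') (g : M →ₛₗ[ρ] M') {n : ℕ} {x : SymmetricAlgebra A M}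
    (hx : x ∈ symGrading A M n) : symMap ρ g x ∈ symGrading A' M' n := by
  induction hx using Submodule.pow_induction_on_left' with
  | algebraMap r => rw [symMap_algebraMap]; exact algebraMap_mem_symGrading _
  | add x y i hx hy ihx ihy => rw [map_add]; exact add_mem ihx ihy
  | mem_mul m hm i x hx ih =>
    obtain ⟨m, rfl⟩ := hm
    rw [map_mul, symMap_ι, Nat.succ_eq_add_one, add_comm]
    exact SetLike.mul_mem_graded (ι_mem_symGrading _) ih

/-- If `A' = A_f` and `M' = M_f`, then `Sym_{A'} M'` is the localization of `Sym_A M` at `f`. -/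
lemma symMap_isLocalization (ρ : A →+* A') (g : M →ₛₗ[ρ] M') (f : A)
    (hρ : letI := ρ.toAlgebra; IsLocalization.Away f A')
    (hsurj : ∀ y, ∃ (n : ℕ) (x : M), ρ f ^ n • y = g x)
    (hinj : ∀ x y, g x = g y → ∃ n : ℕ, f ^ n • x = f ^ n • y) :
    letI := (symMap ρ g).toAlgebra
    IsLocalization.Away (algebraMap A (SymmetricAlgebra A M) f) (SymmetricAlgebra A' M') := by
  letI := ρ.toAlgebra
  letI : Module A M' := Module.compHom M' ρ
  haveI : IsScalarTower A A' M' := ⟨fun a b m => by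
    change (ρ a * b) • m = ρ a • b • m
    rw [mul_smul]⟩
  have hunit : IsUnit (ρ f) := IsLocalization.Away.algebraMap_isUnit f
  let gl : M →ₗ[A] M' :=
    { toFun := g, map_add' := map_add g, map_smul' := fun a m => g.map_smulₛₗ a m }
  haveI : IsLocalizedModule (.powers f) gl := by
    refine ⟨?_, ?_, ?_⟩
    · rintro ⟨_, n, rfl⟩
      rw [Module.End.isUnit_iff]
      have h1 : ∀ m : M', (algebraMap A (Module.End A M') (f ^ n)) m = (hunit.unit ^ n) • m := by
        intro m
        change ρ (f ^ n) • m = _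
        rw [map_pow]; rfl
      constructor
      · intro x y hxy
        change (algebraMap A (Module.End A M') (f ^ n)) x =
          (algebraMap A (Module.End A M') (f ^ n)) y at hxy
        rw [h1, h1] at hxy
        exact smul_left_cancel _ hxy
      · intro y
        refine ⟨(hunit.unit ^ n)⁻¹ • y, ?_⟩
        change (algebraMap A (Module.End A M') (f ^ n)) _ = y
        rw [h1, smul_inv_smul]
    · intro y
      obtain ⟨n, x, h⟩ := hsurj y
      refine ⟨(x, ⟨f ^ n, n, rfl⟩), ?_⟩
      change ρ (f ^ n) • y = g x
      rw [map_pow, h]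
    · intro x y hxy
      obtain ⟨n, hn⟩ := hinj x y hxy
      exact ⟨⟨f ^ n, n, rfl⟩, hn⟩
  have lift_exists : ∀ {L : Type _} [CommRing L] (l : SymmetricAlgebra A M →+* L),
      IsUnit (l (algebraMap A _ f)) →
        ∃ Ψ : SymmetricAlgebra A' M' →+* L, Ψ.comp (symMap ρ g) = l := by
    intro L _ l hl
    let lA : A →+* L := l.comp (algebraMap A _)
    have hFL : IsUnit (lA f) := hl
    let lA' : A' →+* L := IsLocalization.Away.lift (g := lA) f hFL
    have hlA' : ∀ a, lA' (ρ a) = lA a := fun a => IsLocalization.Away.lift_eq f hFL a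
    letI : Algebra A' L := lA'.toAlgebra
    letI : Algebra A L := lA.toAlgebra
    haveI : IsScalarTower A A' L := IsScalarTower.of_algebraMap_eq fun a => (hlA' a).symm
    let j : M →ₗ[A] L :=
      { toFun := fun m => l (SymmetricAlgebra.ι A M m)
        map_add' := fun x y => by rw [map_add, map_add]
        map_smul' := fun a m => by
          rw [Algebra.smul_def (A := L), map_smul, Algebra.smul_def, map_mul]; rfl }
    let j' : M' →ₗ[A] L := IsLocalizedModule.lift (.powers f) gl j (by
      rintro ⟨_, n, rfl⟩
      rw [Module.End.isUnit_iff]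
      have h1 : ∀ m : L, (algebraMap A (Module.End A L) (f ^ n)) m =
          ((hFL.unit ^ n : Lˣ) : L) * m := by
        intro m
        change (f ^ n) • m = _
        rw [Algebra.smul_def, map_pow]
        rfl
      constructor
      · intro x y hxy
        change (algebraMap A (Module.End A L) (f ^ n)) x =
          (algebraMap A (Module.End A L) (f ^ n)) y at hxy
        rw [h1, h1] at hxy
        exact (Units.mul_right_inj _).mp hxy
      · intro y
        refine ⟨((hFL.unit ^ n)⁻¹ : Lˣ) * y, ?_⟩
        change (algebraMap A (Module.End A L) (f ^ n)) _ = y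
        rw [h1, Units.mul_inv_cancel_left])
    have hj' : ∀ m, j' (g m) = j m := fun m => IsLocalizedModule.lift_apply (.powers f) gl j _ m
    let j'' : M' →ₗ[A'] L := j'.extendScalarsOfIsLocalization (.powers f) A'
    refine ⟨(SymmetricAlgebra.lift j'').toRingHom, sym_ringHom_ext ?_ ?_⟩
    · intro a
      simp only [RingHom.comp_apply, symMap_algebraMap]
      exact (AlgHom.commutes (SymmetricAlgebra.lift j'') _).trans (hlA' a)
    · intro m
      simp only [RingHom.comp_apply, symMap_ι]
      exact (SymmetricAlgebra.lift_ι_apply j'' _).trans (hj' m)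
  let F := algebraMap A (SymmetricAlgebra A M) f
  let L := Localization.Away F
  obtain ⟨Ψ, hΨ⟩ := lift_exists (algebraMap (SymmetricAlgebra A M) L)
    (IsLocalization.Away.algebraMap_isUnit F)
  letI := (symMap ρ g).toAlgebra
  have key : ∀ y, ∃ (n : ℕ) (x : SymmetricAlgebra A M),
      (algebraMap A' (SymmetricAlgebra A' M') (ρ f)) ^ n * y = symMap ρ g x := by
    intro y
    induction y using SymmetricAlgebra.induction with
    | algebraMap r =>
      obtain ⟨n, a, h⟩ := IsLocalization.Away.surj f r
      refine ⟨n, algebraMap _ _ a, ?_⟩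
      rw [symMap_algebraMap, ← map_pow, ← map_mul, mul_comm]
      exact congrArg _ h
    | ι x =>
      obtain ⟨n, a, h⟩ := hsurj x
      refine ⟨n, SymmetricAlgebra.ι A M a, ?_⟩
      rw [symMap_ι, ← h, map_smul, Algebra.smul_def, map_pow]
    | mul a b ha hb =>
      obtain ⟨n, x, hx⟩ := ha
      obtain ⟨m, y, hy⟩ := hb
      refine ⟨n + m, x * y, ?_⟩
      rw [map_mul, ← hx, ← hy]; ring
    | add a b ha hb =>
      obtain ⟨n, x, hx⟩ := ha
      obtain ⟨m, y, hy⟩ := hb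
      refine ⟨n + m, algebraMap _ _ f ^ m * x + algebraMap _ _ f ^ n * y, ?_⟩
      rw [map_add, map_mul, map_mul, ← hx, ← hy, map_pow, map_pow, symMap_algebraMap]; ring
  refine ⟨?_, ?_, ?_⟩
  · rintro ⟨_, n, rfl⟩
    change IsUnit (symMap ρ g (algebraMap A _ f ^ n))
    rw [map_pow, symMap_algebraMap]
    exact (hunit.map _).pow n
  · intro y
    obtain ⟨n, x, h⟩ := key y
    refine ⟨(x, ⟨_, n, rfl⟩), ?_⟩
    change y * symMap ρ g (algebraMap A _ f ^ n) = symMap ρ g x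
    rw [map_pow, symMap_algebraMap, mul_comm, h]
  · intro x y hxy
    have : algebraMap _ L x = algebraMap _ L y := by
      rw [← hΨ]; exact congrArg Ψ hxy
    exact (IsLocalization.eq_iff_exists (.powers F) L).mp this

end SymmetricAlgebra

section Quotient

open scoped DirectSum

variable {S : Type*} [CommRing S] {σ : Type*} [SetLike σ S] [AddSubgroupClass σ S]
  (𝒜 : ℕ → σ) [GradedRing 𝒜]

/-- The grading of a quotient of a graded ring by an ideal. -/
def quotGrading (I : Ideal S) (n : ℕ) : AddSubgroup (S ⧸ I) :=
  (AddSubgroup.ofClass (𝒜 n)).map (Ideal.Quotient.mk I).toAddMonoidHom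

lemma mem_quotGrading {I : Ideal S} {n : ℕ} {y : S ⧸ I} :
    y ∈ quotGrading 𝒜 I n ↔ ∃ x ∈ 𝒜 n, Ideal.Quotient.mk I x = y := Iff.rfl

variable {𝒜}

/-- The quotient of a graded ring by a homogeneous ideal is graded. -/
@[reducible]
def quotGradedRing {I : Ideal S} (hI : I.IsHomogeneous 𝒜) : GradedRing (quotGrading 𝒜 I) := by
  haveI hm : SetLike.GradedMonoid (quotGrading 𝒜 I) :=
    { one_mem := ⟨1, SetLike.one_mem_graded 𝒜, map_one (Ideal.Quotient.mk I)⟩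
      mul_mem := by
        rintro i j _ _ ⟨x, hx, rfl⟩ ⟨y, hy, rfl⟩
        exact ⟨x * y, SetLike.mul_mem_graded hx hy, map_mul (Ideal.Quotient.mk I) _ _⟩ }
  have hint : DirectSum.IsInternal (quotGrading 𝒜 I) := by
    constructor
    · rw [injective_iff_map_eq_zero]
      intro x hx
      classical
      have hch : ∀ i, ∃ a ∈ 𝒜 i, Ideal.Quotient.mk I a = (x i : S ⧸ I) := fun i => (x i).2
      choose a ha hax using hch
      rw [DirectSum.coeAddMonoidHom_eq_dfinsuppSum] at hx
      have h1 : ∑ i ∈ x.support, a i ∈ I := by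
        rw [← Ideal.Quotient.eq_zero_iff_mem, map_sum]
        rw [← hx]
        simp only [hax]
        rfl
      ext i
      by_cases hi : i ∈ x.support
      · have h2 := hI i h1
        rw [DirectSum.decompose_sum, DFinsupp.finsetSum_apply,
          AddSubmonoidClass.coe_finsetSum, Finset.sum_eq_single i] at h2
        · rw [DirectSum.decompose_of_mem_same 𝒜 (ha i)] at h2
          rw [← hax i, Ideal.Quotient.eq_zero_iff_mem.mpr h2]; rfl
        · intro j _ hj
          rw [DirectSum.decompose_of_mem_ne 𝒜 (ha j) hj]
        · exact fun h => absurd hi h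
      · rw [DFinsupp.notMem_support_iff.mp hi]; rfl
    · intro y
      classical
      obtain ⟨s, rfl⟩ := Ideal.Quotient.mk_surjective y
      refine ⟨∑ i ∈ (DirectSum.decompose 𝒜 s).support, DirectSum.of
        (fun i => quotGrading 𝒜 I i) i ⟨_, (DirectSum.decompose 𝒜 s i : S), SetLike.coe_mem _, rfl⟩, ?_⟩
      rw [map_sum]
      simp only [DirectSum.coeAddMonoidHom_of]
      conv_rhs => rw [← DirectSum.sum_support_decompose 𝒜 s, map_sum]
      rfl
  exact { hm, hint.chooseDecomposition with }

end Quotient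

section ProjBaseChange

open HomogeneousLocalization HomogeneousIdeal

variable {A A' S S' : Type u} [CommRing A] [CommRing A'] [CommRing S] [CommRing S']
  {σ τ : Type u} [SetLike σ S] [AddSubgroupClass σ S] [SetLike τ S'] [AddSubgroupClass τ S']
  (𝒜 : ℕ → σ) [GradedRing 𝒜] (ℬ : ℕ → τ) [GradedRing ℬ]

/-- The structure morphism `Proj S ⟶ Spec A` of a graded `A`-algebra `S`. -/
def projToSpec (α : A →+* S) (hα : ∀ a, α a ∈ 𝒜 0) : Proj 𝒜 ⟶ Spec (.of A) :=
  Proj.toSpecZero 𝒜 ≫ Spec.map (CommRingCat.ofHom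
    ({ toFun := fun a => ⟨α a, hα a⟩
       map_one' := Subtype.ext (map_one α)
       map_mul' := fun _ _ => Subtype.ext (map_mul α _ _)
       map_zero' := Subtype.ext (map_zero α)
       map_add' := fun _ _ => Subtype.ext (map_add α _ _) } : A →+* 𝒜 0))

variable {𝒜 ℬ}

/-- The degree zero constant `α a` as an element of the homogeneous localization at `s`. -/
def awayConst (α : A →+* S) (hα : ∀ a, α a ∈ 𝒜 0) (s : S) : A →+* Away 𝒜 s :=
  (fromZeroRingHom 𝒜 _).comp
    ({ toFun := fun a => ⟨α a, hα a⟩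
       map_one' := Subtype.ext (map_one α)
       map_mul' := fun _ _ => Subtype.ext (map_mul α _ _)
       map_zero' := Subtype.ext (map_zero α)
       map_add' := fun _ _ => Subtype.ext (map_add α _ _) } : A →+* 𝒜 0)

lemma awayConst_val (α : A →+* S) (hα : ∀ a, α a ∈ 𝒜 0) (s : S) (a : A) :
    (awayConst (𝒜 := 𝒜) α hα s a).val = algebraMap S _ (α a) := by
  change (fromZeroRingHom 𝒜 _ _).val = _
  simp only [fromZeroRingHom]
  exact (Localization.mk_one_eq_algebraMap _)

lemma awayι_projToSpec (α : A →+* S) (hα : ∀ a, α a ∈ 𝒜 0) {m : ℕ} (s : S) (hs : s ∈ 𝒜 m)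
    (hm : 0 < m) : Proj.awayι 𝒜 s hs hm ≫ projToSpec 𝒜 α hα =
      Spec.map (CommRingCat.ofHom (awayConst (𝒜 := 𝒜) α hα s)) := by
  rw [projToSpec, Proj.awayι_toSpecZero_assoc, ← Spec.map_comp]
  rfl

variable (φ : 𝒜 →+*ᵍ ℬ) (ρ : A →+* A') (α : A →+* S) (α' : A' →+* S')

/-- A homogeneous element of a localization at a degree zero element is, up to a power of that
element, the image of a homogeneous element of the same degree. -/
lemma exists_homogeneous_lift (hα : ∀ a, α a ∈ 𝒜 0) (f : A)
    (hS : letI := φ.toRingHom.toAlgebra; IsLocalization.Away (α f) S') {n : ℕ} {b : S'}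
    (hb : b ∈ ℬ n) : ∃ (N : ℕ) (a : S), a ∈ 𝒜 n ∧ φ a = φ (α f) ^ N * b := by
  letI := φ.toRingHom.toAlgebra
  obtain ⟨N, a, h⟩ := IsLocalization.Away.surj (α f) b
  have h' : φ a = φ (α f) ^ N * b := by rw [mul_comm]; exact h.symm
  refine ⟨N, DirectSum.decompose 𝒜 a n, SetLike.coe_mem _, ?_⟩
  rw [φ.map_directSumDecompose, h']
  have : φ (α f) ^ N * b ∈ ℬ n := by
    have h0 : φ (α f) ^ N ∈ ℬ 0 := by
      have := SetLike.pow_mem_graded N (φ.map_mem (hα f))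
      simpa using this
    simpa using SetLike.mul_mem_graded h0 hb
  exact DirectSum.decompose_of_mem_same ℬ this

/-- Localizing a graded ring at a degree zero element satisfies the condition under which `Proj`
is functorial. -/
lemma irrelevant_le_map (hα : ∀ a, α a ∈ 𝒜 0) (f : A)
    (hS : letI := φ.toRingHom.toAlgebra; IsLocalization.Away (α f) S') :
    HomogeneousIdeal.irrelevant ℬ ≤ (HomogeneousIdeal.irrelevant 𝒜).map φ := by
  letI := φ.toRingHom.toAlgebra
  rw [← toIdeal_le_toIdeal_iff, HomogeneousIdeal.toIdeal_irrelevant_le]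
  intro i hi b hb
  obtain ⟨N, a, ha, h⟩ := exists_homogeneous_lift φ α hα f hS hb
  have hu : IsUnit (φ (α f) ^ N) := (IsLocalization.Away.algebraMap_isUnit (α f)).pow N
  have hmem : φ a ∈ (HomogeneousIdeal.irrelevant 𝒜).toIdeal.map φ :=
    Ideal.mem_map_of_mem _ (HomogeneousIdeal.mem_irrelevant_of_mem 𝒜 hi ha)
  rw [h] at hmem
  exact (Ideal.unit_mul_mem_iff_mem _ hu).mp hmem

lemma awayMap_awayConst (hα : ∀ a, α a ∈ 𝒜 0) (hα' : ∀ a, α' a ∈ ℬ 0)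
    (comm : ∀ a, φ (α a) = α' (ρ a)) {m : ℕ} (s : S) (hs : s ∈ 𝒜 m) (a : A) :
    Away.map φ s (awayConst (𝒜 := 𝒜) α hα s a) = awayConst (𝒜 := ℬ) α' hα' (φ s) (ρ a) := by
  have h0 : α a ∈ 𝒜 (0 • m) := by simpa using hα a
  have : awayConst (𝒜 := 𝒜) α hα s a = Away.mk 𝒜 hs 0 (α a) h0 := by
    apply HomogeneousLocalization.val_injective
    rw [awayConst_val, Away.val_mk, ← Localization.mk_one_eq_algebraMap]
    congr 1
    exact Subtype.ext (pow_zero s).symm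
  rw [this, Away.map_mk]
  apply HomogeneousLocalization.val_injective
  rw [awayConst_val, Away.val_mk, comm, ← Localization.mk_one_eq_algebraMap]
  congr 1
  exact Subtype.ext (pow_zero _)

lemma awayMap_isLocalization (hα : ∀ a, α a ∈ 𝒜 0) (hα' : ∀ a, α' a ∈ ℬ 0)
    (comm : ∀ a, φ (α a) = α' (ρ a)) (f : A)
    (hS : letI := φ.toRingHom.toAlgebra; IsLocalization.Away (α f) S')
    (hρ : IsUnit (ρ f)) {m : ℕ} (s : S) (hs : s ∈ 𝒜 m) :
    letI := (Away.map φ s).toAlgebra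
    IsLocalization.Away (awayConst (𝒜 := 𝒜) α hα s f) (Away ℬ (φ s)) := by
  letI := φ.toRingHom.toAlgebra
  letI := (Away.map φ s).toAlgebra
  have hconst := awayMap_awayConst φ ρ α α' hα hα' comm s hs
  have hu : IsUnit (φ (α f)) := IsLocalization.Away.algebraMap_isUnit (α f)
  refine ⟨?_, ?_, ?_⟩
  · rintro ⟨_, n, rfl⟩
    change IsUnit (Away.map φ s (awayConst (𝒜 := 𝒜) α hα s f ^ n))
    rw [map_pow, hconst]
    exact (hρ.map _).pow n
  · intro y
    obtain ⟨n, b, hb, rfl⟩ := Away.mk_surjective ℬ (φ.map_mem hs) y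
    obtain ⟨N, a, ha, h⟩ := exists_homogeneous_lift φ α hα f hS hb
    refine ⟨(Away.mk 𝒜 hs n a ha, ⟨_, N, rfl⟩), ?_⟩
    change _ * Away.map φ s (awayConst (𝒜 := 𝒜) α hα s f ^ N) = Away.map φ s _
    rw [map_pow, hconst, Away.map_mk]
    apply HomogeneousLocalization.val_injective
    rw [HomogeneousLocalization.val_mul, HomogeneousLocalization.val_pow, awayConst_val,
      Away.val_mk, Away.val_mk, h, ← comm, mul_comm, ← map_pow,
      ← Localization.mk_one_eq_algebraMap, Localization.mk_mul, one_mul]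
    rfl
  · intro x y hxy
    obtain ⟨z, hz⟩ : ∃ z, z = x - y := ⟨_, rfl⟩
    have hz0 : Away.map φ s z = 0 := by
      rw [hz, map_sub, sub_eq_zero]; exact hxy
    suffices H : ∃ N : ℕ, awayConst (𝒜 := 𝒜) α hα s f ^ N * z = 0 by
      obtain ⟨N, hN⟩ := H
      refine ⟨⟨_, N, rfl⟩, ?_⟩
      rwa [hz, mul_sub, sub_eq_zero] at hN
    obtain ⟨n, a, ha, rfl⟩ := Away.mk_surjective 𝒜 hs z
    rw [Away.map_mk] at hz0
    have hz1 := congrArg HomogeneousLocalization.val hz0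
    rw [Away.val_mk, HomogeneousLocalization.val_zero, Localization.mk_eq_mk',
      IsLocalization.mk'_eq_zero_iff] at hz1
    obtain ⟨⟨_, k, rfl⟩, hk⟩ := hz1
    have hk' : φ (s ^ k * a) = φ 0 := by
      rw [map_mul, map_pow, map_zero]; exact hk
    obtain ⟨⟨_, N, rfl⟩, hN⟩ := (IsLocalization.eq_iff_exists (.powers (α f)) S').mp hk'
    refine ⟨N, ?_⟩
    apply HomogeneousLocalization.val_injective
    rw [HomogeneousLocalization.val_mul, HomogeneousLocalization.val_pow, awayConst_val,
      Away.val_mk, HomogeneousLocalization.val_zero, ← map_pow,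
      ← Localization.mk_one_eq_algebraMap, Localization.mk_mul, Localization.mk_eq_mk',
      IsLocalization.mk'_eq_zero_iff]
    refine ⟨⟨_, k, rfl⟩, ?_⟩
    have : (α f) ^ N * (s ^ k * a) = 0 := by simpa using hN
    calc s ^ k * (α f ^ N * a) = (α f) ^ N * (s ^ k * a) := by ring
      _ = 0 := this

/-- If `A' = A_f` and `S' = S_f`, then `Proj S'` is the base change of `Proj S` along
`Spec A' ⟶ Spec A`. -/
lemma isPullback_projMap (hα : ∀ a, α a ∈ 𝒜 0) (hα' : ∀ a, α' a ∈ ℬ 0)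
    (comm : ∀ a, φ (α a) = α' (ρ a)) (f : A) (hφ : HomogeneousIdeal.irrelevant ℬ ≤
      (HomogeneousIdeal.irrelevant 𝒜).map φ)
    (hρ : letI := ρ.toAlgebra; IsLocalization.Away f A')
    (hS : letI := φ.toRingHom.toAlgebra; IsLocalization.Away (α f) S') :
    IsPullback (Proj.map φ hφ) (projToSpec ℬ α' hα') (projToSpec 𝒜 α hα)
      (Spec.map (CommRingCat.ofHom ρ)) := by
  refine Scheme.isPullback_of_openCover _ _ _ _ (Proj.affineOpenCover 𝒜).openCover ?_
  rintro ⟨⟨m, hm⟩, ⟨s, hs⟩⟩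
  replace hs : s ∈ 𝒜 m := hs
  have hρu : IsUnit (ρ f) := by
    letI := ρ.toAlgebra
    exact IsLocalization.Away.algebraMap_isUnit f
  have hloc := awayMap_isLocalization φ ρ α α' hα hα' comm f hS hρu s hs
  have hs' : φ s ∈ ℬ m := φ.map_mem hs
  have sq1 : IsPullback (Spec.map (CommRingCat.ofHom (Away.map φ s)))
      (Proj.awayι ℬ (φ s) hs' hm) (Proj.awayι 𝒜 s hs hm) (Proj.map φ hφ) := by
    refine IsOpenImmersion.isPullback _ _ _ _ (Proj.awayι_comp_map φ hφ hm s hs) ?_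
    rw [Proj.opensRange_awayι, Proj.opensRange_awayι, Proj.map_preimage_basicOpen]
  have sq2 : IsPullback (Spec.map (CommRingCat.ofHom (Away.map φ s)))
      (Spec.map (CommRingCat.ofHom (awayConst (𝒜 := ℬ) α' hα' (φ s))))
      (Spec.map (CommRingCat.ofHom (awayConst (𝒜 := 𝒜) α hα s)))
      (Spec.map (CommRingCat.ofHom ρ)) := by
    letI := ρ.toAlgebra
    letI := (Away.map φ s).toAlgebra
    haveI : IsLocalization (.powers f) A' := hρ
    haveI : IsLocalization ((Submonoid.powers f).map (awayConst (𝒜 := 𝒜) α hα s))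
        (Away ℬ (φ s)) := by
      rw [Submonoid.map_powers]; exact hloc
    refine isPullback_SpecMap_of_isPushout _ _ _ _
      (CommRingCat.isPushout_of_isLocalization (Rₘ := A') (Sₘ := Away ℬ (φ s))
        (awayConst (𝒜 := 𝒜) α hα s) (awayConst (𝒜 := ℬ) α' hα' (φ s)) ?_ (.powers f))
    ext a : 1
    exact (awayMap_awayConst φ ρ α α' hα hα' comm s hs a).symm
  rw [← awayι_projToSpec α hα s hs hm, ← awayι_projToSpec α' hα' (φ s) hs' hm] at sq2
  refine sq2.of_iso sq1.flip.isoPullback (Iso.refl _) (Iso.refl _) (Iso.refl _) ?_ ?_ ?_ ?_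
  · simp only [Iso.refl_hom]
    exact sq1.flip.isoPullback_hom_snd.symm
  · simp only [Iso.refl_hom, Category.comp_id]
    exact (sq1.flip.isoPullback_hom_fst_assoc _).symm
  · simp only [Iso.refl_hom, Category.comp_id]
    rfl
  · simp

end ProjBaseChange

section GradedAlgebraSheaf

open Scheme Scheme.AffineZariskiSite Opposite

/-- A quasi-coherent graded `𝒪_X`-algebra, given by its sections over the affine open subschemes:
a graded `Γ(X, U)`-algebra `S(U)` for every affine open `U`, with restriction maps to the basic
open subsets such that `S(D(f)) = S(U)_f` (`NatTrans.Coequifibered`, see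
`coequifibered_iff_forall_isLocalizationAway`). -/
structure GradedAlgebraSheaf (X : Scheme.{u}) where
  algebra : X.AffineZariskiSiteᵒᵖ ⥤ CommRingCat.{u}
  unit : (toOpensFunctor X).op ⋙ X.presheaf ⟶ algebra
  coequifibered : unit.Coequifibered
  grading : ∀ U, ℕ → AddSubgroup (algebra.obj U)
  gradedRing : ∀ U, GradedRing (grading U)
  map_mem : ∀ {U V} (f : U ⟶ V) (n : ℕ) (x : algebra.obj U), x ∈ grading U n →
    (algebra.map f).hom x ∈ grading V n
  unit_mem : ∀ U (a : Γ(X, U.unop.1)), (unit.app U).hom a ∈ grading U 0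

namespace GradedAlgebraSheaf

variable {X : Scheme.{u}} (S : GradedAlgebraSheaf X)

instance (U) : GradedRing (S.grading U) := S.gradedRing U

/-- Restriction, as a graded ring homomorphism. -/
def res {U V : X.AffineZariskiSiteᵒᵖ} (f : U ⟶ V) : S.grading U →+*ᵍ S.grading V where
  toRingHom := (S.algebra.map f).hom
  map_mem h := S.map_mem f _ _ h

lemma isLocalization_res (U : X.AffineZariskiSite) (f : Γ(X, U.1)) :
    letI := (S.res (homOfLE (U.basicOpen_le f)).op).toRingHom.toAlgebra
    IsLocalization.Away ((S.unit.app (.op U)).hom f) (S.algebra.obj (.op (U.basicOpen f))) :=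
  coequifibered_iff_forall_isLocalizationAway.mp S.coequifibered U f

lemma res_unit {U V : X.AffineZariskiSiteᵒᵖ} (f : U ⟶ V) (a : Γ(X, U.unop.1)) :
    S.res f ((S.unit.app U).hom a) =
      (S.unit.app V).hom ((((toOpensFunctor X).op ⋙ X.presheaf).map f).hom a) :=
  congr($(S.unit.naturality f).hom a).symm

lemma irrelevant_le {U V : X.AffineZariskiSiteᵒᵖ} (f : U ⟶ V) :
    HomogeneousIdeal.irrelevant (S.grading V) ≤
      (HomogeneousIdeal.irrelevant (S.grading U)).map (S.res f) := by
  obtain ⟨⟨g, hg⟩⟩ := f.unop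
  obtain ⟨U⟩ := U
  obtain ⟨V⟩ := V
  obtain rfl : U.basicOpen g = V := Subtype.ext hg
  exact irrelevant_le_map (S.res f) (S.unit.app (.op U)).hom (S.unit_mem _) g
    (S.isLocalization_res U g)

lemma res_id (U : X.AffineZariskiSiteᵒᵖ) : S.res (𝟙 U) = .id _ := by
  ext x
  exact congr($(S.algebra.map_id U).hom x)

lemma res_comp {U V W : X.AffineZariskiSiteᵒᵖ} (f : U ⟶ V) (g : V ⟶ W) :
    S.res (f ≫ g) = (S.res g).comp (S.res f) := by
  ext x
  exact congr($(S.algebra.map_comp f g).hom x)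

lemma projMap_congr {U V : X.AffineZariskiSiteᵒᵖ} {f g : S.grading U →+*ᵍ S.grading V}
    (h : f = g) (hf : HomogeneousIdeal.irrelevant (S.grading V) ≤
      (HomogeneousIdeal.irrelevant (S.grading U)).map f)
    (hg : HomogeneousIdeal.irrelevant (S.grading V) ≤
      (HomogeneousIdeal.irrelevant (S.grading U)).map g) : Proj.map f hf = Proj.map g hg := by
  subst h; rfl

/-- The structure morphism `Proj S(U) ⟶ U`. -/
def projLocal (U : X.AffineZariskiSite) : Proj (S.grading (.op U)) ⟶ U.1 :=
  projToSpec (S.grading (.op U)) (S.unit.app (.op U)).hom (S.unit_mem _) ≫ U.2.isoSpec.inv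

lemma isPullback_isoSpec_inv {U V : X.AffineZariskiSite} (f : V ⟶ U) :
    IsPullback (Spec.map (X.presheaf.map (homOfLE (toOpens_mono f.le)).op)) V.2.isoSpec.inv
      U.2.isoSpec.inv (X.homOfLE (toOpens_mono f.le)) := by
  refine IsPullback.of_vert_isIso ⟨?_⟩
  rw [Iso.eq_inv_comp, ← Category.assoc, Iso.comp_inv_eq]
  exact (Scheme.Opens.toSpecΓ_SpecMap_presheaf_map ..)

lemma isPullback_projLocal {U V : X.AffineZariskiSite} (f : V ⟶ U) :
    IsPullback (Proj.map (S.res f.op) (S.irrelevant_le f.op)) (S.projLocal V) (S.projLocal U)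
      (X.homOfLE (toOpens_mono f.le)) := by
  obtain ⟨g, hg⟩ := f.le
  obtain rfl : U.basicOpen g = V := Subtype.ext hg
  have h := isPullback_projMap (S.res f.op)
    (X.presheaf.map (homOfLE (X.basicOpen_le g)).op).hom
    (S.unit.app (.op U)).hom (S.unit.app (.op (U.basicOpen g))).hom (S.unit_mem _)
    (S.unit_mem (.op (U.basicOpen g)))
    (fun a => S.res_unit f.op a) g (S.irrelevant_le f.op)
    (U.2.isLocalization_basicOpen g) (S.isLocalization_res U g)
  exact h.paste_vert (isPullback_isoSpec_inv f)

/-- The gluing data for the relative homogeneous spectrum: `Proj S(U)` over every affine open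
`U`. -/
def projGluingData : (directedCover X).RelativeGluingData where
  functor :=
    { obj := fun U => Proj (S.grading (.op U))
      map := fun {V U} f => Proj.map (S.res f.op) (S.irrelevant_le f.op)
      map_id := fun U => by
        rw [← Proj.map_id]
        exact projMap_congr S (S.res_id _) _ _
      map_comp := fun {U V W} f g => by
        rw [← Proj.map_comp]
        exact projMap_congr S (S.res_comp _ _) _ _ }
  natTrans :=
    { app := fun U => S.projLocal U
      naturality := fun {V U} f => (S.isPullback_projLocal f).w }
  equifibered := fun {V U} f => (S.isPullback_projLocal f)

instance : (S.projGluingData.functor ⋙ Scheme.forget).IsLocallyDirected :=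
  Cover.RelativeGluingData.instIsLocallyDirectedI₀CompFunctorForgetOfIsThin ..

/-- The relative homogeneous spectrum `Proj S` of a quasi-coherent graded `𝒪_X`-algebra. -/
def relativeProj : Scheme.{u} := S.projGluingData.glued

/-- The structure morphism `Proj S ⟶ X`. -/
def relativeProjToBase : S.relativeProj ⟶ X := S.projGluingData.toBase

end GradedAlgebraSheaf

end GradedAlgebraSheaf

section BlowupAlgebra

open Polynomial

variable {R R' A A' : Type*} [CommRing R] [CommRing R'] [CommRing A] [CommRing A']

/-- Let `π : R → A` be surjective with kernel `K`, let `I` be an ideal of `A` and let `J` be its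
preimage in `R`. This is the homogeneous ideal `⨁ K J^(n-1)` of the Rees algebra `⨁ J^n` of `J`;
in degree `0` it is `K` (here `0 - 1 = 0`). -/
def blowupIdeal (π : R →+* A) (I : Ideal A) : Ideal (reesAlgebra (I.comap π)) where
  carrier := {p | ∀ n, p.1.coeff n ∈ RingHom.ker π * (I.comap π) ^ (n - 1)}
  add_mem' ha hb n := by
    simpa using add_mem (ha n) (hb n)
  zero_mem' n := by simp
  smul_mem' q p hp n := by
    simp only [smul_eq_mul, MulMemClass.coe_mul, Polynomial.coeff_mul]
    refine sum_mem ?_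
    rintro ⟨i, j⟩ hij
    have hij' : i + j = n := Finset.HasAntidiagonal.mem_antidiagonal.mp hij
    have h1 := Ideal.mul_mem_mul (q.2 i) (hp j)
    have h2 : (I.comap π) ^ i * (RingHom.ker π * (I.comap π) ^ (j - 1)) ≤
        RingHom.ker π * (I.comap π) ^ (n - 1) := by
      rw [mul_left_comm, ← pow_add]
      exact Ideal.mul_mono_right (Ideal.pow_le_pow_right (by omega))
    exact h2 h1

/-- The blow-up algebra `⨁ J^n / K J^(n-1)` of `Spec A` along the closed subscheme `V(I)` which
corresponds to the closed embedding `Spec A ⊆ Spec R` given by `π`. For `π = id` it is the Rees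
algebra of `I`. -/
def BlowupAlgebra (π : R →+* A) (I : Ideal A) : Type _ :=
  reesAlgebra (I.comap π) ⧸ blowupIdeal π I

instance (π : R →+* A) (I : Ideal A) : CommRing (BlowupAlgebra π I) :=
  inferInstanceAs (CommRing (reesAlgebra (I.comap π) ⧸ blowupIdeal π I))

/-- The quotient map from the Rees algebra of `J`. -/
def BlowupAlgebra.mk (π : R →+* A) (I : Ideal A) :
    reesAlgebra (I.comap π) →+* BlowupAlgebra π I :=
  Ideal.Quotient.mk (blowupIdeal π I)

lemma BlowupAlgebra.mk_surjective (π : R →+* A) (I : Ideal A) :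
    Function.Surjective (BlowupAlgebra.mk π I) :=
  Ideal.Quotient.mk_surjective

lemma BlowupAlgebra.mk_eq_zero {π : R →+* A} {I : Ideal A} {p : reesAlgebra (I.comap π)} :
    BlowupAlgebra.mk π I p = 0 ↔
      ∀ n, p.1.coeff n ∈ RingHom.ker π * (I.comap π) ^ (n - 1) :=
  Ideal.Quotient.eq_zero_iff_mem

/-- The class of `r t^n`, where `r ∈ J^n`. -/
def BlowupAlgebra.mon (π : R →+* A) (I : Ideal A) (n : ℕ) (r : R) (hr : r ∈ (I.comap π) ^ n) :
    BlowupAlgebra π I :=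
  BlowupAlgebra.mk π I ⟨monomial n r, reesAlgebra.monomial_mem.mpr hr⟩

lemma BlowupAlgebra.mon_eq_zero {π : R →+* A} {I : Ideal A} {n : ℕ} {r : R}
    {hr : r ∈ (I.comap π) ^ n} (h : r ∈ RingHom.ker π * (I.comap π) ^ (n - 1)) :
    BlowupAlgebra.mon π I n r hr = 0 := by
  refine BlowupAlgebra.mk_eq_zero.mpr fun m => ?_
  simp only [coeff_monomial]
  split_ifs with hm
  · exact hm ▸ h
  · exact zero_mem _

lemma BlowupAlgebra.mon_add {π : R →+* A} {I : Ideal A} {n : ℕ} {r s : R}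
    (hr : r ∈ (I.comap π) ^ n) (hs : s ∈ (I.comap π) ^ n) :
    BlowupAlgebra.mon π I n (r + s) (add_mem hr hs) =
      BlowupAlgebra.mon π I n r hr + BlowupAlgebra.mon π I n s hs := by
  rw [mon, mon, mon, ← map_add]
  congr 1
  exact Subtype.ext (map_add (monomial n) r s)

lemma BlowupAlgebra.mon_mul {π : R →+* A} {I : Ideal A} {n m : ℕ} {r s : R}
    (hr : r ∈ (I.comap π) ^ n) (hs : s ∈ (I.comap π) ^ m) (hrs : r * s ∈ (I.comap π) ^ (n + m)) :
    BlowupAlgebra.mon π I n r hr * BlowupAlgebra.mon π I m s hs =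
      BlowupAlgebra.mon π I (n + m) (r * s) hrs := by
  rw [mon, mon, mon, ← map_mul]
  congr 1
  exact Subtype.ext (monomial_mul_monomial n m r s)

lemma BlowupAlgebra.mon_congr {π : R →+* A} {I : Ideal A} {n : ℕ} {r s : R}
    (hr : r ∈ (I.comap π) ^ n) (hs : s ∈ (I.comap π) ^ n)
    (h : r - s ∈ RingHom.ker π * (I.comap π) ^ (n - 1)) :
    BlowupAlgebra.mon π I n r hr = BlowupAlgebra.mon π I n s hs := by
  have := BlowupAlgebra.mon_add hs (sub_mem hr hs)
  rw [BlowupAlgebra.mon_eq_zero h, add_zero] at this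
  rw [← this]
  congr 1
  ring

/-- The structure of an `A`-algebra on the blow-up algebra. -/
def blowupUnit (π : R →+* A) (hπ : Function.Surjective π) (I : Ideal A) :
    A →+* BlowupAlgebra π I :=
  π.liftOfSurjective hπ ⟨(BlowupAlgebra.mk π I).comp (algebraMap R _), by
    intro r hr
    rw [RingHom.mem_ker, RingHom.comp_apply]
    have h := BlowupAlgebra.mon_eq_zero (π := π) (I := I) (n := 0) (r := r) (hr := by simp)
      (by simpa using hr)
    exact h⟩

lemma blowupUnit_apply (π : R →+* A) (hπ : Function.Surjective π) (I : Ideal A) (r : R) :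
    blowupUnit π hπ I (π r) = BlowupAlgebra.mon π I 0 r (by simp) :=
  RingHom.liftOfRightInverse_comp_apply _ _ _ _ _

/-- The identification of `I` with the degree one part `J / K` of the blow-up algebra. -/
def blowupOne (π : R →+* A) (hπ : Function.Surjective π) (I : Ideal A) :
    I →+ BlowupAlgebra π I :=
  AddMonoidHom.mk' (fun x => BlowupAlgebra.mon π I 1 (Function.surjInv hπ x) (by
      simp [Function.surjInv_eq hπ])) (by
    intro x y
    rw [← BlowupAlgebra.mon_add]
    refine BlowupAlgebra.mon_congr _ _ ?_
    simp [RingHom.mem_ker, Function.surjInv_eq hπ])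

/-- The canonical homomorphism of graded `A`-algebras from the symmetric algebra of `I` to the
blow-up algebra which is the identification `I = J / K` in degree one. -/
def toBlowup (π : R →+* A) (hπ : Function.Surjective π) (I : Ideal A) :
    SymmetricAlgebra A I →+* BlowupAlgebra π I :=
  symLift (A := A) (M := I) (blowupUnit π hπ I) (blowupOne π hπ I) (by
    intro a x
    obtain ⟨r, rfl⟩ := hπ a
    rw [blowupUnit_apply]
    simp only [blowupOne, AddMonoidHom.mk'_apply]
    have hrx : r * Function.surjInv hπ x ∈ (I.comap π) ^ (0 + 1) := by
      simpa [Function.surjInv_eq hπ] using I.mul_mem_left (π r) x.2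
    rw [BlowupAlgebra.mon_mul _ _ hrx]
    refine BlowupAlgebra.mon_congr (n := 1) _ (by simpa using hrx) ?_
    simp [RingHom.mem_ker, Function.surjInv_eq hπ])

variable (π : R →+* A) (hπ : Function.Surjective π) (I : Ideal A)

lemma toBlowup_algebraMap (r : R) :
    toBlowup π hπ I (algebraMap A _ (π r)) = BlowupAlgebra.mon π I 0 r (by simp) :=
  (symLift_algebraMap (A := A) (M := I) _ _ _ _).trans (blowupUnit_apply π hπ I r)

lemma toBlowup_ι (r : R) (hr : π r ∈ I) :
    toBlowup π hπ I (SymmetricAlgebra.ι A I ⟨π r, hr⟩) =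
      BlowupAlgebra.mon π I 1 r (by simpa using hr) := by
  refine (symLift_ι (A := A) (M := I) _ _ _ _).trans ?_
  refine BlowupAlgebra.mon_congr (by simpa [Function.surjInv_eq hπ] using hr) _ ?_
  simp [RingHom.mem_ker, Function.surjInv_eq hπ]

lemma toBlowup_homogeneous {n : ℕ} {x : SymmetricAlgebra A I} (hx : x ∈ symGrading A I n) :
    ∃ (r : R) (hr : r ∈ (I.comap π) ^ n), toBlowup π hπ I x = BlowupAlgebra.mon π I n r hr := by
  induction hx using Submodule.pow_induction_on_left' with
  | algebraMap a =>
    obtain ⟨r, rfl⟩ := hπ a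
    exact ⟨r, _, toBlowup_algebraMap π hπ I r⟩
  | add x y i hx hy ihx ihy =>
    obtain ⟨r, hr, h⟩ := ihx
    obtain ⟨s, hs, h'⟩ := ihy
    exact ⟨r + s, add_mem hr hs, by rw [map_add, h, h', BlowupAlgebra.mon_add]⟩
  | mem_mul m hm i x hx ih =>
    obtain ⟨⟨m, hm⟩, rfl⟩ := hm
    obtain ⟨r, rfl⟩ := hπ m
    obtain ⟨s, hs, h'⟩ := ih
    have hr : r ∈ (I.comap π) ^ 1 := by simpa using hm
    have hrs : r * s ∈ (I.comap π) ^ (1 + i) := by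
      rw [pow_add]; exact Ideal.mul_mem_mul hr hs
    have key : toBlowup π hπ I (SymmetricAlgebra.ι A I ⟨π r, hm⟩ * x) =
        BlowupAlgebra.mon π I (1 + i) (r * s) hrs := by
      rw [map_mul, h', toBlowup_ι, BlowupAlgebra.mon_mul]
    rw [Nat.succ_eq_add_one, add_comm]
    exact ⟨r * s, hrs, key⟩

/-- The blow-up algebras are graded quotients of the symmetric algebra. -/
lemma ker_toBlowup_isHomogeneous :
    (RingHom.ker (toBlowup π hπ I)).IsHomogeneous (symGrading A I) := by
  classical
  intro i x hx
  have hch : ∀ n, ∃ (r : R) (hr : r ∈ (I.comap π) ^ n), toBlowup π hπ I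
      (DirectSum.decompose (symGrading A I) x n) = BlowupAlgebra.mon π I n r hr :=
    fun n => toBlowup_homogeneous π hπ I (SetLike.coe_mem _)
  choose r hr h using hch
  rw [RingHom.mem_ker] at hx ⊢
  rw [← DirectSum.sum_support_decompose (symGrading A I) x, map_sum] at hx
  simp only [h] at hx
  simp only [BlowupAlgebra.mon, ← map_sum] at hx
  rw [BlowupAlgebra.mk_eq_zero] at hx
  have hc := hx i
  by_cases hi : i ∈ (DirectSum.decompose (symGrading A I) x).support
  · rw [h i]
    refine BlowupAlgebra.mon_eq_zero ?_
    simpa [Polynomial.finsetSum_coeff, coeff_monomial, hi] using hc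
  · rw [DFinsupp.notMem_support_iff.mp hi]
    simp

lemma toBlowup_surjective : Function.Surjective (toBlowup π hπ I) := by
  intro b
  obtain ⟨⟨p, hp⟩, rfl⟩ := BlowupAlgebra.mk_surjective π I b
  suffices H : ∀ p (_ : p ∈ Algebra.adjoin R
      (Submodule.map (monomial 1 : R →ₗ[R] R[X]) (I.comap π) : Set R[X]))
      (hp : p ∈ reesAlgebra (I.comap π)), ∃ x, toBlowup π hπ I x = BlowupAlgebra.mk π I ⟨p, hp⟩ from
    H p (by rw [adjoin_monomial_eq_reesAlgebra]; exact hp) hp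
  intro p h
  have hle := (adjoin_monomial_eq_reesAlgebra (I.comap π)).le
  induction h using Algebra.adjoin_induction with
  | mem p hp =>
    intro _
    obtain ⟨r, hr, rfl⟩ := hp
    exact ⟨_, toBlowup_ι π hπ I r hr⟩
  | algebraMap r => exact fun _ => ⟨_, toBlowup_algebraMap π hπ I r⟩
  | add p q hp hq ihp ihq =>
    intro _
    obtain ⟨x, hx⟩ := ihp (hle hp)
    obtain ⟨y, hy⟩ := ihq (hle hq)
    exact ⟨x + y, by rw [map_add, hx, hy, ← map_add]; rfl⟩
  | mul p q hp hq ihp ihq =>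
    intro _
    obtain ⟨x, hx⟩ := ihp (hle hp)
    obtain ⟨y, hy⟩ := ihq (hle hq)
    exact ⟨x * y, by rw [map_mul, hx, hy, ← map_mul]; rfl⟩

variable (π' : R' →+* A') (hπ' : Function.Surjective π') (I' : Ideal A') (θ : R →+* R')
  (ρ : A →+* A')

/-- A commutative square of rings induces a homomorphism of Rees algebras. -/
def reesMap (hθ : π'.comp θ = ρ.comp π) (hI : I ≤ I'.comap ρ) :
    reesAlgebra (I.comap π) →+* reesAlgebra (I'.comap π') :=
  ((Polynomial.mapRingHom θ).comp (reesAlgebra (I.comap π)).val.toRingHom).codRestrict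
    (reesAlgebra (I'.comap π')).toSubring (by
    intro p n
    change (p.1.map θ).coeff n ∈ _
    rw [Polynomial.coeff_map]
    have h1 : (I.comap π).map θ ≤ I'.comap π' := by
      rw [Ideal.map_le_iff_le_comap, Ideal.comap_comap, hθ, ← Ideal.comap_comap]
      exact Ideal.comap_mono hI
    have h2 := Ideal.mem_map_of_mem θ (p.2 n)
    rw [Ideal.map_pow] at h2
    exact Ideal.pow_right_mono h1 n h2)

/-- Functoriality of the blow-up algebra. -/
def blowupMap (hθ : π'.comp θ = ρ.comp π) (hI : I ≤ I'.comap ρ) :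
    BlowupAlgebra π I →+* BlowupAlgebra π' I' :=
  Ideal.quotientMap (blowupIdeal π' I') (reesMap π I π' I' θ ρ hθ hI) (by
    intro p hp n
    change (p.1.map θ).coeff n ∈ _
    rw [Polynomial.coeff_map]
    have h1 : (I.comap π).map θ ≤ I'.comap π' := by
      rw [Ideal.map_le_iff_le_comap, Ideal.comap_comap, hθ, ← Ideal.comap_comap]
      exact Ideal.comap_mono hI
    have h0 : (RingHom.ker π).map θ ≤ RingHom.ker π' := by
      rw [Ideal.map_le_iff_le_comap]
      intro r hr
      have := congr($hθ r)
      simp only [RingHom.comp_apply] at this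
      rw [Ideal.mem_comap, RingHom.mem_ker, this, (RingHom.mem_ker.mp hr), map_zero]
    have h2 := Ideal.mem_map_of_mem θ (hp n)
    rw [Ideal.map_mul, Ideal.map_pow] at h2
    exact Ideal.mul_mono h0 (Ideal.pow_right_mono h1 _) h2)

lemma blowupMap_mk (hθ : π'.comp θ = ρ.comp π) (hI : I ≤ I'.comap ρ)
    (p : reesAlgebra (I.comap π)) :
    blowupMap π I π' I' θ ρ hθ hI (BlowupAlgebra.mk π I p) =
      BlowupAlgebra.mk π' I' (reesMap π I π' I' θ ρ hθ hI p) := rfl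

/-- The restriction of a ring homomorphism to ideals, as a semilinear map. -/
def idealRes (hI : I ≤ I'.comap ρ) : I →ₛₗ[ρ] I' where
  toFun x := ⟨ρ x, hI x.2⟩
  map_add' x y := Subtype.ext (by simp)
  map_smul' a x := Subtype.ext (by simp)

lemma blowupMap_mon (hθ : π'.comp θ = ρ.comp π) (hI : I ≤ I'.comap ρ) (n : ℕ) (r : R)
    (hr : r ∈ (I.comap π) ^ n) (hr' : θ r ∈ (I'.comap π') ^ n) :
    blowupMap π I π' I' θ ρ hθ hI (BlowupAlgebra.mon π I n r hr) =
      BlowupAlgebra.mon π' I' n (θ r) hr' := by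
  refine (Ideal.quotientMap_mk ..).trans ?_
  refine congrArg (BlowupAlgebra.mk π' I') ?_
  exact Subtype.ext (Polynomial.map_monomial θ)

lemma blowupMap_toBlowup (hθ : π'.comp θ = ρ.comp π) (hI : I ≤ I'.comap ρ)
    (x : SymmetricAlgebra A I) :
    blowupMap π I π' I' θ ρ hθ hI (toBlowup π hπ I x) =
      toBlowup π' hπ' I' (symMap ρ (idealRes I I' ρ hI) x) := by
  suffices h : (blowupMap π I π' I' θ ρ hθ hI).comp (toBlowup π hπ I) =
      (toBlowup π' hπ' I').comp (symMap ρ (idealRes I I' ρ hI)) from congr($h x)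
  have hθr : ∀ r, π' (θ r) = ρ (π r) := fun r => congr($hθ r)
  apply sym_ringHom_ext (A := A) (M := I)
  · intro a
    obtain ⟨r, rfl⟩ := hπ a
    rw [RingHom.comp_apply, RingHom.comp_apply, toBlowup_algebraMap, symMap_algebraMap,
      ← hθr, toBlowup_algebraMap, blowupMap_mon]
  · rintro ⟨m, hm⟩
    obtain ⟨r, rfl⟩ := hπ m
    have hm' : π' (θ r) ∈ I' := by rw [hθr]; exact hI hm
    have : idealRes I I' ρ hI ⟨π r, hm⟩ = ⟨π' (θ r), hm'⟩ := Subtype.ext (hθr r).symm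
    rw [RingHom.comp_apply, RingHom.comp_apply, toBlowup_ι, symMap_ι, this, toBlowup_ι,
      blowupMap_mon]

end BlowupAlgebra

section QuasiSym

variable {k A A' : Type u} [CommRing k] [CommRing A] [CommRing A']

/-- A closed embedding over `k` of `Spec A` in an ambient affine `k`-scheme `Spec R` (not
necessarily nonsingular), that is, a surjective homomorphism of `k`-algebras `R → A`. The
`k`-algebra structure of `A` is given by `φ`. -/
structure Ambient (φ : k →+* A) where
  ring : Type u
  [commRing : CommRing ring]
  str : k →+* ring
  proj : ring →+* A
  surjective : Function.Surjective proj
  comm : proj.comp str = φ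

attribute [instance] Ambient.commRing

/-- A morphism of ambient schemes, compatible with the embeddings of `Spec A`; in terms of rings,
a homomorphism of `k`-algebras over `A`. -/
structure Ambient.Hom {φ : k →+* A} (R R' : Ambient φ) where
  hom : R.ring →+* R'.ring
  str_comm : hom.comp R.str = R'.str
  proj_comm : R'.proj.comp hom = R.proj

variable (φ : k →+* A) (I : Ideal A)

/-- The blow-up algebra of `Spec A` along `V(I)` corresponding to an ambient scheme. -/
abbrev Ambient.algebra {φ : k →+* A} (R : Ambient φ) (I : Ideal A) : Type u :=
  BlowupAlgebra R.proj I

/-- The homomorphism of blow-up algebras induced by a morphism of ambient schemes. -/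
def Ambient.Hom.map {φ : k →+* A} {R R' : Ambient φ} (θ : R.Hom R') (I : Ideal A) :
    R.algebra I →+* R'.algebra I :=
  blowupMap R.proj I R'.proj I θ.hom (RingHom.id A) (by rw [θ.proj_comm]; rfl) le_rfl

/-- The elements of the symmetric algebra of `I` that vanish in the blow-up algebras corresponding
to all ambient schemes. -/
def quasiSymIdeal : Ideal (SymmetricAlgebra A I) :=
  ⨅ R : Ambient φ, RingHom.ker (toBlowup R.proj R.surjective I)

/-- The quasi-symmetric algebra of `I`: the inverse limit of the system of the blow-up algebras
`⨁ J^n / K J^(n-1)` of `Spec A` along `V(I)` corresponding to all closed embeddings of `Spec A`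
in an ambient scheme. All of them are quotients of the symmetric algebra, and the inverse limit is
the quotient by the intersection of the kernels; see `quasiSym_isLimit` for its universal
property. -/
def QuasiSym : Type u := SymmetricAlgebra A I ⧸ quasiSymIdeal φ I

instance : CommRing (QuasiSym φ I) :=
  inferInstanceAs (CommRing (SymmetricAlgebra A I ⧸ quasiSymIdeal φ I))

/-- The quotient map from the symmetric algebra. -/
def QuasiSym.mk : SymmetricAlgebra A I →+* QuasiSym φ I := Ideal.Quotient.mk (quasiSymIdeal φ I)

lemma QuasiSym.mk_surjective : Function.Surjective (QuasiSym.mk φ I) :=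
  Ideal.Quotient.mk_surjective

lemma QuasiSym.mk_eq_zero {x : SymmetricAlgebra A I} :
    QuasiSym.mk φ I x = 0 ↔ x ∈ quasiSymIdeal φ I := Ideal.Quotient.eq_zero_iff_mem

lemma mem_quasiSymIdeal {x : SymmetricAlgebra A I} : x ∈ quasiSymIdeal φ I ↔
    ∀ R : Ambient φ, toBlowup R.proj R.surjective I x = 0 := by
  simp [quasiSymIdeal, RingHom.mem_ker]

/-- The projection from the inverse limit. -/
def QuasiSym.toAmbient (R : Ambient φ) : QuasiSym φ I →+* R.algebra I :=
  Ideal.Quotient.lift (quasiSymIdeal φ I) (toBlowup R.proj R.surjective I)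
    fun _ hx => (mem_quasiSymIdeal φ I).mp hx R

/-- The ambient affine space `Spec k[x_a | a ∈ A]`. -/
def Ambient.free : Ambient φ where
  ring := MvPolynomial A k
  str := MvPolynomial.C
  proj := MvPolynomial.eval₂Hom φ id
  surjective a := ⟨MvPolynomial.X a, by simp⟩
  comm := by ext; simp

/-- The ambient affine space maps to every other ambient scheme. -/
def Ambient.freeHom (R : Ambient φ) : (Ambient.free φ).Hom R where
  hom := MvPolynomial.eval₂Hom R.str (Function.surjInv R.surjective)
  str_comm := RingHom.ext fun c => MvPolynomial.eval₂Hom_C _ _ c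
  proj_comm := by
    refine MvPolynomial.ringHom_ext ?_ ?_
    · intro c
      change R.proj (MvPolynomial.eval₂Hom _ _ (MvPolynomial.C c)) =
        MvPolynomial.eval₂Hom φ id (MvPolynomial.C c)
      rw [MvPolynomial.eval₂Hom_C, MvPolynomial.eval₂Hom_C]
      exact congr($(R.comm) c)
    · intro a
      change R.proj (MvPolynomial.eval₂Hom _ _ (MvPolynomial.X a)) =
        MvPolynomial.eval₂Hom φ id (MvPolynomial.X a)
      rw [MvPolynomial.eval₂Hom_X', MvPolynomial.eval₂Hom_X', Function.surjInv_eq R.surjective]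
      rfl

lemma symMap_id (x : SymmetricAlgebra A I) :
    symMap (RingHom.id A) (idealRes I I (RingHom.id A) le_rfl) x = x := by
  have : symMap (RingHom.id A) (idealRes I I (RingHom.id A) le_rfl) =
      RingHom.id (SymmetricAlgebra A I) := by
    apply sym_ringHom_ext
    · intro a; simp
    · intro m; rw [symMap_ι]; rfl
  exact congr($this x)

lemma Ambient.Hom.map_toBlowup {R R' : Ambient φ} (θ : R.Hom R') (x : SymmetricAlgebra A I) :
    θ.map I (toBlowup R.proj R.surjective I x) = toBlowup R'.proj R'.surjective I x := by
  refine (blowupMap_toBlowup R.proj R.surjective I R'.proj R'.surjective I θ.hom (RingHom.id A)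
    _ _ x).trans ?_
  rw [symMap_id]

lemma mem_quasiSymIdeal_iff_free {x : SymmetricAlgebra A I} : x ∈ quasiSymIdeal φ I ↔
    toBlowup (Ambient.free φ).proj (Ambient.free φ).surjective I x = 0 := by
  rw [mem_quasiSymIdeal]
  refine ⟨fun h => h _, fun h R => ?_⟩
  rw [← (Ambient.freeHom φ R).map_toBlowup, h, map_zero]

/-- The quasi-symmetric algebra is the inverse limit of the blow-up algebras corresponding to all
ambient schemes: an element is the same as a family of elements of the blow-up algebras which is
compatible with all morphisms of ambient schemes. -/
theorem quasiSym_isLimit (b : ∀ R : Ambient φ, R.algebra I)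
    (hb : ∀ (R R' : Ambient φ) (θ : R.Hom R'), θ.map I (b R) = b R') :
    ∃! q : QuasiSym φ I, ∀ R, QuasiSym.toAmbient φ I R q = b R := by
  obtain ⟨x, hx⟩ := toBlowup_surjective (Ambient.free φ).proj (Ambient.free φ).surjective I
    (b (Ambient.free φ))
  refine ⟨QuasiSym.mk φ I x, fun R => ?_, ?_⟩
  · change toBlowup R.proj R.surjective I x = b R
    rw [← (Ambient.freeHom φ R).map_toBlowup, hx, hb]
  · intro q hq
    obtain ⟨y, rfl⟩ := QuasiSym.mk_surjective φ I q
    rw [← sub_eq_zero, ← map_sub, QuasiSym.mk_eq_zero, mem_quasiSymIdeal_iff_free, map_sub,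
      sub_eq_zero, hx]
    exact hq (Ambient.free φ)

lemma QuasiSym.toAmbient_map {R R' : Ambient φ} (θ : R.Hom R') (q : QuasiSym φ I) :
    θ.map I (QuasiSym.toAmbient φ I R q) = QuasiSym.toAmbient φ I R' q := by
  obtain ⟨y, rfl⟩ := QuasiSym.mk_surjective φ I q
  exact θ.map_toBlowup φ I y

/-- The grading of the quasi-symmetric algebra. -/
def QuasiSym.grading (n : ℕ) : AddSubgroup (QuasiSym φ I) :=
  quotGrading (symGrading A I) (quasiSymIdeal φ I) n

lemma quasiSymIdeal_isHomogeneous : (quasiSymIdeal φ I).IsHomogeneous (symGrading A I) := by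
  intro i x hx
  rw [mem_quasiSymIdeal] at hx ⊢
  exact fun R => ker_toBlowup_isHomogeneous R.proj R.surjective I i (hx R)

instance : GradedRing (QuasiSym.grading φ I) :=
  quotGradedRing (quasiSymIdeal_isHomogeneous φ I)

variable (φ' : k →+* A') (I' : Ideal A') (ρ : A →+* A')

lemma quasiSymIdeal_le_comap (hρ : ρ.comp φ = φ') (hI : I ≤ I'.comap ρ) :
    quasiSymIdeal φ I ≤ (quasiSymIdeal φ' I').comap (symMap ρ (idealRes I I' ρ hI)) := by
  intro x hx
  rw [Ideal.mem_comap, mem_quasiSymIdeal]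
  intro R'
  let F : Ambient φ :=
    { ring := RingHom.eqLocus (R'.proj.comp (RingHom.fst R'.ring A)) (ρ.comp (RingHom.snd R'.ring A))
      str := (R'.str.prod φ).codRestrict _ (by
        intro c
        have := congr($(R'.comm) c)
        have h2 := congr($hρ c)
        simp only [RingHom.comp_apply] at this h2
        change R'.proj (R'.str c) = ρ (φ c)
        rw [this, h2])
      proj := (RingHom.snd R'.ring A).comp (Subring.subtype _)
      surjective := by
        intro a
        obtain ⟨r, hr⟩ := R'.surjective (ρ a)
        exact ⟨⟨(r, a), hr⟩, rfl⟩
      comm := rfl }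
  have h := (mem_quasiSymIdeal φ I).mp hx F
  rw [← blowupMap_toBlowup F.proj F.surjective I R'.proj R'.surjective I'
    ((RingHom.fst R'.ring A).comp (Subring.subtype _)) ρ (by ext ⟨p, hp⟩; exact hp) hI, h, map_zero]

/-- Functoriality of the quasi-symmetric algebra. -/
def quasiSymMap (hρ : ρ.comp φ = φ') (hI : I ≤ I'.comap ρ) : QuasiSym φ I →+* QuasiSym φ' I' :=
  Ideal.quotientMap (quasiSymIdeal φ' I') (symMap ρ (idealRes I I' ρ hI))
    (quasiSymIdeal_le_comap φ I φ' I' ρ hρ hI)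

lemma quasiSymMap_mk (hρ : ρ.comp φ = φ') (hI : I ≤ I'.comap ρ) (x : SymmetricAlgebra A I) :
    quasiSymMap φ I φ' I' ρ hρ hI (QuasiSym.mk φ I x) =
      QuasiSym.mk φ' I' (symMap ρ (idealRes I I' ρ hI) x) :=
  Ideal.quotientMap_mk ..

end QuasiSym

section Localization

variable {k A A' : Type u} [CommRing k] [CommRing A] [CommRing A']

lemma idealRes_surj (I : Ideal A) (ρ : A →+* A') (f : A)
    (hloc : letI := ρ.toAlgebra; IsLocalization.Away f A') (I' : Ideal A') (hI' : I.map ρ = I')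
    (hI : I ≤ I'.comap ρ) (y : I') : ∃ (n : ℕ) (x : I), ρ f ^ n • y = idealRes I I' ρ hI x := by
  letI := ρ.toAlgebra
  obtain ⟨y, hy⟩ := y
  subst hI'
  obtain ⟨⟨x, ⟨_, n, rfl⟩⟩, h⟩ :=
    (IsLocalization.mem_map_algebraMap_iff (.powers f) A').mp hy
  refine ⟨n, x, Subtype.ext ?_⟩
  change ρ f ^ n * y = ρ x
  rw [mul_comm, ← map_pow]
  exact h

lemma idealRes_inj (I : Ideal A) (ρ : A →+* A') (f : A)
    (hloc : letI := ρ.toAlgebra; IsLocalization.Away f A') (I' : Ideal A')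
    (hI : I ≤ I'.comap ρ) (x y : I) (h : idealRes I I' ρ hI x = idealRes I I' ρ hI y) :
    ∃ n : ℕ, f ^ n • x = f ^ n • y := by
  letI := ρ.toAlgebra
  obtain ⟨⟨_, n, rfl⟩, hn⟩ := (IsLocalization.eq_iff_exists (.powers f) A').mp
    (congrArg Subtype.val h)
  exact ⟨n, Subtype.ext hn⟩

lemma isLocalizationAway_toAlgebra [Algebra A A'] (f : A) [h : IsLocalization.Away f A'] :
    letI := (algebraMap A A').toAlgebra
    IsLocalization.Away f A' := by
  have h1 := h.map_units
  have h2 := IsLocalization.surj (S := A') (.powers f)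
  have h3 := fun x y => IsLocalization.exists_of_eq (S := A') (M := .powers f) (x := x) (y := y)
  letI := (algebraMap A A').toAlgebra
  exact ⟨h1, h2, h3 _ _⟩

lemma blowupMap_eq_zero {R R' : Type u} [CommRing R] [CommRing R'] (π : R →+* A) (π' : R' →+* A')
    (I : Ideal A) (I' : Ideal A') (θ : R →+* R') (ρ : A →+* A') (hθ : π'.comp θ = ρ.comp π)
    (hI : I ≤ I'.comap ρ) (F : R)
    (hlocR : letI := θ.toAlgebra; IsLocalization.Away F R')
    (hloc : letI := ρ.toAlgebra; IsLocalization.Away (π F) A') (hI' : I.map ρ = I')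
    (b : BlowupAlgebra π I) (hb : blowupMap π I π' I' θ ρ hθ hI b = 0) :
    ∃ N : ℕ, BlowupAlgebra.mon π I 0 F (by simp) ^ N * b = 0 := by
  letI := ρ.toAlgebra
  letI := θ.toAlgebra
  have hπ' : ∀ r, π' (θ r) = ρ (π r) := fun r => congr($hθ r)
  have hle : ∀ (L : Ideal A), (L.map ρ).comap π' ≤ (L.comap π).map θ := by
    intro L y hy
    rw [Ideal.mem_comap] at hy
    obtain ⟨n, r, h⟩ := IsLocalization.Away.surj F y
    change y * θ F ^ n = θ r at h
    have h1 : ρ (π r) ∈ L.map ρ := by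
      rw [← hπ', ← h, map_mul]; exact Ideal.mul_mem_right _ _ hy
    obtain ⟨_, ⟨m, rfl⟩, hm⟩ :=
      (IsLocalization.algebraMap_mem_map_algebraMap_iff (.powers (π F)) A' L _).mp h1
    refine (IsLocalization.mem_map_algebraMap_iff (.powers F) R').mpr ?_
    refine ⟨⟨⟨F ^ m * r, ?_⟩, ⟨F ^ (m + n), m + n, rfl⟩⟩, ?_⟩
    · rw [Ideal.mem_comap, map_mul, map_pow]; exact hm
    · change y * θ (F ^ (m + n)) = θ (F ^ m * r)
      rw [map_mul, map_pow, map_pow, ← h]; ring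
  obtain ⟨p, rfl⟩ := BlowupAlgebra.mk_surjective π I b
  rw [blowupMap_mk] at hb
  have h1 : ∀ n, ∃ m : ℕ, F ^ m * p.1.coeff n ∈ RingHom.ker π * (I.comap π) ^ (n - 1) := by
    intro n
    have h2 : (p.1.map θ).coeff n ∈ RingHom.ker π' * (I'.comap π') ^ (n - 1) :=
      BlowupAlgebra.mk_eq_zero.mp hb n
    rw [Polynomial.coeff_map] at h2
    have hK : RingHom.ker π' ≤ (RingHom.ker π).map θ := by
      have := hle ⊥
      rwa [Ideal.map_bot] at this
    have hJ := hle I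
    rw [hI'] at hJ
    have h3 := Ideal.mul_mono hK (Ideal.pow_right_mono hJ (n - 1)) h2
    rw [← Ideal.map_pow, ← Ideal.map_mul] at h3
    obtain ⟨_, ⟨m, rfl⟩, hm⟩ :=
      (IsLocalization.algebraMap_mem_map_algebraMap_iff (.powers F) R' _ _).mp h3
    exact ⟨m, hm⟩
  choose m hm using h1
  refine ⟨p.1.support.sup m, ?_⟩
  rw [BlowupAlgebra.mon, ← map_pow, ← map_mul, BlowupAlgebra.mk_eq_zero]
  intro n
  have hcoeff : ∀ N : ℕ, ((⟨Polynomial.monomial 0 F, reesAlgebra.monomial_mem.mpr (by simp)⟩ :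
      reesAlgebra (I.comap π)) ^ N * p).1.coeff n = F ^ N * p.1.coeff n := by
    intro N
    change ((Polynomial.monomial 0 F) ^ N * p.1).coeff n = _
    rw [Polynomial.monomial_zero_left, ← Polynomial.C_pow, Polynomial.coeff_C_mul]
  rw [hcoeff]
  by_cases hn : n ∈ p.1.support
  · have : F ^ (p.1.support.sup m) = F ^ (p.1.support.sup m - m n) * F ^ (m n) := by
      rw [← pow_add, Nat.sub_add_cancel (Finset.le_sup hn)]
    rw [this, mul_assoc]
    exact Ideal.mul_mem_left _ _ (hm n)
  · rw [Polynomial.notMem_support_iff.mp hn, mul_zero]; exact zero_mem _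

variable (φ : k →+* A) (I : Ideal A) (φ' : k →+* A') (I' : Ideal A') (ρ : A →+* A')

lemma quasiSymMap_isLocalization (hρ : ρ.comp φ = φ') (hI : I ≤ I'.comap ρ) (f : A)
    (hloc : letI := ρ.toAlgebra; IsLocalization.Away f A') (hI' : I.map ρ = I') :
    letI := (quasiSymMap φ I φ' I' ρ hρ hI).toAlgebra
    IsLocalization.Away (QuasiSym.mk φ I (algebraMap A _ f)) (QuasiSym φ' I') := by
  have hsym := symMap_isLocalization ρ (idealRes I I' ρ hI) f hloc
    (idealRes_surj I ρ f hloc I' hI' hI) (idealRes_inj I ρ f hloc I' hI)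
  have hinj : ∀ x, symMap ρ (idealRes I I' ρ hI) x ∈ quasiSymIdeal φ' I' →
      ∃ n : ℕ, algebraMap A (SymmetricAlgebra A I) f ^ n * x ∈ quasiSymIdeal φ I := by
    intro x hx
    let P := Ambient.free φ
    obtain ⟨F, hF⟩ := P.surjective f
    letI := ρ.toAlgebra
    have hu : IsUnit ((ρ.comp P.proj) F) := by
      rw [RingHom.comp_apply, hF]; exact IsLocalization.Away.algebraMap_isUnit f
    let π' : Localization.Away F →+* A' := IsLocalization.Away.lift F hu
    have hπ' : ∀ r, π' (algebraMap _ _ r) = ρ (P.proj r) := IsLocalization.Away.lift_eq F hu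
    let P' : Ambient φ' :=
      { ring := Localization.Away F
        str := (algebraMap P.ring _).comp P.str
        proj := π'
        surjective := by
          intro a
          obtain ⟨n, b, h⟩ := IsLocalization.Away.surj f a
          obtain ⟨r, rfl⟩ := P.surjective b
          let y : Submonoid.powers F := ⟨F ^ n, n, rfl⟩
          refine ⟨IsLocalization.mk' (Localization.Away F) r y, ?_⟩
          have h2 := congrArg π' (IsLocalization.mk'_spec (Localization.Away F) r y)
          rw [map_mul, hπ', hπ', map_pow, map_pow, hF] at h2
          have hu' : IsUnit (ρ f ^ n) := (IsLocalization.Away.algebraMap_isUnit f).pow n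
          exact hu'.mul_right_cancel (h2.trans h.symm)
        comm := by
          ext c
          have h1 := congr($(P.comm) c)
          have h2 := congr($hρ c)
          simp only [RingHom.comp_apply] at h1 h2 ⊢
          rw [hπ', h1, h2] }
    have h0 := (mem_quasiSymIdeal φ' I').mp hx P'
    rw [← blowupMap_toBlowup P.proj P.surjective I P'.proj P'.surjective I'
      (algebraMap P.ring (Localization.Away F)) ρ (by ext c; exact hπ' c) hI] at h0
    obtain ⟨N, hN⟩ := blowupMap_eq_zero P.proj P'.proj I I'
      (algebraMap P.ring (Localization.Away F)) ρ (by ext c; exact hπ' c) hI F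
      (isLocalizationAway_toAlgebra F) (by rw [hF]; exact hloc) hI' _ h0
    refine ⟨N, (mem_quasiSymIdeal_iff_free φ I).mpr ?_⟩
    change toBlowup P.proj P.surjective I _ = 0
    rw [map_mul, map_pow, ← hF, toBlowup_algebraMap]
    exact hN
  letI := (symMap ρ (idealRes I I' ρ hI)).toAlgebra
  letI := (quasiSymMap φ I φ' I' ρ hρ hI).toAlgebra
  have hmk : ∀ x, algebraMap (QuasiSym φ I) (QuasiSym φ' I') (QuasiSym.mk φ I x) =
      QuasiSym.mk φ' I' (algebraMap _ _ x) := quasiSymMap_mk φ I φ' I' ρ hρ hI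
  refine ⟨?_, ?_, ?_⟩
  · rintro ⟨_, n, rfl⟩
    simp only [← map_pow]
    rw [hmk, map_pow, map_pow]
    exact ((IsLocalization.Away.algebraMap_isUnit (algebraMap A (SymmetricAlgebra A I) f)).pow
      n).map _
  · intro z
    obtain ⟨y, rfl⟩ := QuasiSym.mk_surjective φ' I' z
    obtain ⟨n, x, h⟩ := IsLocalization.Away.surj (algebraMap A (SymmetricAlgebra A I) f) y
    refine ⟨⟨QuasiSym.mk φ I x, ⟨_, n, rfl⟩⟩, ?_⟩
    simp only [← map_pow]
    rw [hmk, hmk, ← map_mul, ← h, map_pow, map_pow]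
  · intro a b hab
    obtain ⟨x, rfl⟩ := QuasiSym.mk_surjective φ I a
    obtain ⟨y, rfl⟩ := QuasiSym.mk_surjective φ I b
    rw [hmk, hmk, ← sub_eq_zero, ← map_sub, ← map_sub, QuasiSym.mk_eq_zero] at hab
    obtain ⟨n, hn⟩ := hinj _ hab
    refine ⟨⟨_, n, rfl⟩, ?_⟩
    rw [← QuasiSym.mk_eq_zero] at hn
    simp only [mul_sub, map_sub, map_mul, map_pow, sub_eq_zero] at hn
    exact hn

lemma quasiSymMap_mem (hρ : ρ.comp φ = φ') (hI : I ≤ I'.comap ρ) {n : ℕ} {x : QuasiSym φ I}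
    (hx : x ∈ QuasiSym.grading φ I n) :
    quasiSymMap φ I φ' I' ρ hρ hI x ∈ QuasiSym.grading φ' I' n := by
  obtain ⟨x, hx, rfl⟩ := hx
  exact ⟨_, symMap_mem _ _ hx, (quasiSymMap_mk φ I φ' I' ρ hρ hI x).symm⟩

end Localization

section QuasiSymSheaf

variable {k A A' A'' : Type u} [CommRing k] [CommRing A] [CommRing A'] [CommRing A'']

lemma quasiSymMap_id (φ : k →+* A) (I : Ideal A) (ρ : A →+* A) (h : ρ = RingHom.id A)
    (hρ : ρ.comp φ = φ) (hI : I ≤ I.comap ρ) (x : QuasiSym φ I) :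
    quasiSymMap φ I φ I ρ hρ hI x = x := by
  subst h
  obtain ⟨x, rfl⟩ := QuasiSym.mk_surjective φ I x
  rw [quasiSymMap_mk]
  exact congrArg _ (symMap_id I x)

lemma quasiSymMap_comp (φ : k →+* A) (I : Ideal A) (φ' : k →+* A') (I' : Ideal A')
    (φ'' : k →+* A'') (I'' : Ideal A'') (ρ : A →+* A') (ρ' : A' →+* A'') (ρ'' : A →+* A'')
    (h : ρ'' = ρ'.comp ρ) (hρ hI hρ' hI' hρ'' hI'') (x : QuasiSym φ I) :
    quasiSymMap φ I φ'' I'' ρ'' hρ'' hI'' x =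
      quasiSymMap φ' I' φ'' I'' ρ' hρ' hI' (quasiSymMap φ I φ' I' ρ hρ hI x) := by
  subst h
  obtain ⟨x, rfl⟩ := QuasiSym.mk_surjective φ I x
  rw [quasiSymMap_mk, quasiSymMap_mk, quasiSymMap_mk]
  refine congrArg _ ?_
  have : symMap (ρ'.comp ρ) (idealRes I I'' (ρ'.comp ρ) hI'') =
      (symMap ρ' (idealRes I' I'' ρ' hI')).comp (symMap ρ (idealRes I I' ρ hI)) := by
    apply sym_ringHom_ext
    · intro a; simp
    · intro m
      rw [RingHom.comp_apply, symMap_ι, symMap_ι, symMap_ι]; rfl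
  exact congr($this x)

open Scheme Scheme.AffineZariskiSite Opposite

variable {X : Scheme.{u}}

/-- The restriction of sections of `𝒪_X` between affine open subschemes. -/
abbrev siteRes {U V : X.AffineZariskiSiteᵒᵖ} (f : U ⟶ V) : Γ(X, U.unop.1) →+* Γ(X, V.unop.1) :=
  (((toOpensFunctor X).op ⋙ X.presheaf).map f).hom

lemma siteRes_id (U : X.AffineZariskiSiteᵒᵖ) : siteRes (𝟙 U) = RingHom.id _ :=
  congr($(((toOpensFunctor X).op ⋙ X.presheaf).map_id U).hom)

lemma siteRes_comp {U V W : X.AffineZariskiSiteᵒᵖ} (f : U ⟶ V) (g : V ⟶ W) :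
    siteRes (f ≫ g) = (siteRes g).comp (siteRes f) :=
  congr($(((toOpensFunctor X).op ⋙ X.presheaf).map_comp f g).hom)

/-- The structure of a `k`-algebra on the sections of a `k`-scheme. -/
def scalars (s : X ⟶ Spec (.of k)) (U : X.Opens) : k →+* Γ(X, U) :=
  ((Scheme.ΓSpecIso (.of k)).inv ≫ s.appTop ≫ X.presheaf.map (homOfLE le_top).op).hom

lemma map_scalars (s : X ⟶ Spec (.of k)) {U V : X.Opens} (h : op U ⟶ op V) :
    (X.presheaf.map h).hom.comp (scalars s U) = scalars s V := by
  rw [scalars, scalars, ← CommRingCat.hom_comp]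
  simp only [Category.assoc, ← Functor.map_comp]
  rfl

lemma ideal_le_comap_siteRes (I : X.IdealSheafData) {U V : X.AffineZariskiSiteᵒᵖ} (f : U ⟶ V) :
    I.ideal U.unop ≤ (I.ideal V.unop).comap (siteRes f) := by
  rw [← Ideal.map_le_iff_le_comap]
  exact (I.map_ideal (U := V.unop) (V := U.unop) (toOpens_mono f.unop.le)).le

/-- The quasi-symmetric blow-up algebra of the affine open subscheme `U`. -/
abbrev quasiSymAt (s : X ⟶ Spec (.of k)) (I : X.IdealSheafData) (U : X.AffineZariskiSiteᵒᵖ) :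
    Type u :=
  QuasiSym (A := Γ(X, U.unop.1)) (scalars s U.unop.1) (I.ideal U.unop)

/-- Restriction of sections of the quasi-symmetric blow-up algebra. -/
def quasiSymRes (s : X ⟶ Spec (.of k)) (I : X.IdealSheafData) {U V : X.AffineZariskiSiteᵒᵖ}
    (f : U ⟶ V) : quasiSymAt s I U →+* quasiSymAt s I V :=
  quasiSymMap (A := Γ(X, U.unop.1)) (A' := Γ(X, V.unop.1)) (scalars s U.unop.1) (I.ideal U.unop)
    (scalars s V.unop.1) (I.ideal V.unop) (siteRes f) (map_scalars s _)
    (ideal_le_comap_siteRes I f)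

lemma quasiSymRes_id (s : X ⟶ Spec (.of k)) (I : X.IdealSheafData) (U : X.AffineZariskiSiteᵒᵖ) :
    quasiSymRes s I (𝟙 U) = RingHom.id _ :=
  RingHom.ext fun x => quasiSymMap_id (A := Γ(X, U.unop.1)) (scalars s U.unop.1)
    (I.ideal U.unop) (siteRes (𝟙 U)) (siteRes_id U) (map_scalars s _)
    (ideal_le_comap_siteRes I (𝟙 U)) x

lemma quasiSymRes_comp (s : X ⟶ Spec (.of k)) (I : X.IdealSheafData)
    {U V W : X.AffineZariskiSiteᵒᵖ} (f : U ⟶ V) (g : V ⟶ W) :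
    quasiSymRes s I (f ≫ g) = (quasiSymRes s I g).comp (quasiSymRes s I f) :=
  RingHom.ext fun x => quasiSymMap_comp (A := Γ(X, U.unop.1)) (A' := Γ(X, V.unop.1))
    (A'' := Γ(X, W.unop.1)) (scalars s U.unop.1) (I.ideal U.unop)
    (scalars s V.unop.1) (I.ideal V.unop) (scalars s W.unop.1) (I.ideal W.unop)
    (siteRes f) (siteRes g) (siteRes (f ≫ g)) (siteRes_comp f g)
    (map_scalars s _) (ideal_le_comap_siteRes I f) (map_scalars s _) (ideal_le_comap_siteRes I g)
    (map_scalars s _) (ideal_le_comap_siteRes I (f ≫ g)) x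

/-- The structure of a `Γ(X, U)`-algebra on the quasi-symmetric blow-up algebra. -/
def quasiSymUnitAt (s : X ⟶ Spec (.of k)) (I : X.IdealSheafData) (U : X.AffineZariskiSiteᵒᵖ) :
    Γ(X, U.unop.1) →+* quasiSymAt s I U :=
  (QuasiSym.mk (A := Γ(X, U.unop.1)) (scalars s U.unop.1) (I.ideal U.unop)).comp
    (algebraMap Γ(X, U.unop.1) (SymmetricAlgebra Γ(X, U.unop.1) (I.ideal U.unop)))

lemma quasiSymUnitAt_naturality (s : X ⟶ Spec (.of k)) (I : X.IdealSheafData)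
    {U V : X.AffineZariskiSiteᵒᵖ} (f : U ⟶ V) (a : Γ(X, U.unop.1)) :
    quasiSymRes s I f (quasiSymUnitAt s I U a) = quasiSymUnitAt s I V (siteRes f a) :=
  (quasiSymMap_mk (A := Γ(X, U.unop.1)) (A' := Γ(X, V.unop.1)) _ _ _ _ (siteRes f) _ _
    (algebraMap _ _ a)).trans (congrArg (QuasiSym.mk (A := Γ(X, V.unop.1)) (scalars s V.unop.1)
      (I.ideal V.unop)) (symMap_algebraMap _ _ a))

/-- The quasi-symmetric blow-up algebra of a `k`-scheme `X` along the closed subscheme defined by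
`I`. -/
def quasiSymSheaf (s : X ⟶ Spec (.of k)) (I : X.IdealSheafData) : GradedAlgebraSheaf X where
  algebra :=
    { obj U := .of (quasiSymAt s I U)
      map f := CommRingCat.ofHom (quasiSymRes s I f)
      map_id U := CommRingCat.hom_ext (quasiSymRes_id s I U)
      map_comp f g := CommRingCat.hom_ext (quasiSymRes_comp s I f g) }
  unit :=
    { app U := CommRingCat.ofHom (quasiSymUnitAt s I U)
      naturality U V f := CommRingCat.hom_ext (RingHom.ext fun a =>
        (quasiSymUnitAt_naturality s I f a).symm) }
  coequifibered := by
    rw [coequifibered_iff_forall_isLocalizationAway]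
    intro U f
    exact quasiSymMap_isLocalization (A := Γ(X, U.1)) (A' := Γ(X, (U.basicOpen f).1))
      (scalars s U.1) (I.ideal U) (scalars s (U.basicOpen f).1)
      (I.ideal (U.basicOpen f)) (siteRes (homOfLE (U.basicOpen_le f)).op) (map_scalars s _)
      (ideal_le_comap_siteRes I (homOfLE (U.basicOpen_le f)).op) f
      (U.2.isLocalization_basicOpen f) (I.map_ideal_basicOpen U f)
  grading U := QuasiSym.grading (A := Γ(X, U.unop.1)) (scalars s U.unop.1) (I.ideal U.unop)
  gradedRing U := inferInstanceAs
    (GradedRing (QuasiSym.grading (A := Γ(X, U.unop.1)) (scalars s U.unop.1) (I.ideal U.unop)))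
  map_mem {U V} f n x hx := quasiSymMap_mem (A := Γ(X, U.unop.1)) (A' := Γ(X, V.unop.1))
    (scalars s U.unop.1) (I.ideal U.unop)
    (scalars s V.unop.1) (I.ideal V.unop) (siteRes f) (map_scalars s _)
    (ideal_le_comap_siteRes I f) hx
  unit_mem U a := ⟨_, algebraMap_mem_symGrading a, rfl⟩

/-- The quasi-symmetric blow-up of a `k`-scheme `X` along the closed subscheme defined by `I`. -/
def quasiBlowup (s : X ⟶ Spec (.of k)) (I : X.IdealSheafData) : Scheme.{u} :=
  (quasiSymSheaf s I).relativeProj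

/-- The structure morphism of the quasi-symmetric blow-up. -/
def quasiBlowupToBase (s : X ⟶ Spec (.of k)) (I : X.IdealSheafData) : quasiBlowup s I ⟶ X :=
  (quasiSymSheaf s I).relativeProjToBase

end QuasiSymSheaf

section SymSheaf

open Scheme Scheme.AffineZariskiSite Opposite

/-- A quasi-coherent `𝒪_X`-module, given by its sections over the affine open subschemes: a
`Γ(X, U)`-module `M(U)` for every affine open `U`, with restriction maps to the basic open subsets
such that `M(D(f)) = M(U)_f` (every section over `D(f)` extends to `U` after multiplication by a
power of `f`, and sections over `U` with the same restriction to `D(f)` agree after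
multiplication by a power of `f`). -/
structure QCohModule (X : Scheme.{u}) where
  obj : X.AffineZariskiSiteᵒᵖ → Type u
  addCommGroup : ∀ U, AddCommGroup (obj U)
  module : ∀ U, Module Γ(X, U.unop.1) (obj U)
  res : ∀ {U V} (f : U ⟶ V), obj U →ₛₗ[siteRes f] obj V
  res_id : ∀ U (x : obj U), res (𝟙 U) x = x
  res_comp : ∀ {U V W} (f : U ⟶ V) (g : V ⟶ W) (x : obj U), res (f ≫ g) x = res g (res f x)
  exists_eq_res : ∀ (U : X.AffineZariskiSite) (f : Γ(X, U.1)) (y : obj (.op (U.basicOpen f))),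
    ∃ (n : ℕ) (x : obj (.op U)), siteRes (homOfLE (U.basicOpen_le f)).op f ^ n • y =
      res (homOfLE (U.basicOpen_le f)).op x
  exists_smul_eq : ∀ (U : X.AffineZariskiSite) (f : Γ(X, U.1)) (x y : obj (.op U)),
    res (homOfLE (U.basicOpen_le f)).op x = res (homOfLE (U.basicOpen_le f)).op y →
      ∃ n : ℕ, f ^ n • x = f ^ n • y

namespace QCohModule

variable {X : Scheme.{u}} (M : QCohModule X)

instance (U) : AddCommGroup (M.obj U) := M.addCommGroup U

instance (U) : Module Γ(X, U.unop.1) (M.obj U) := M.module U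

instance (U : X.AffineZariskiSite) : Module Γ(X, U.1) (M.obj (.op U)) := M.module (.op U)

/-- The symmetric algebra of the module of sections. -/
abbrev symAt (U : X.AffineZariskiSiteᵒᵖ) : Type u :=
  SymmetricAlgebra Γ(X, U.unop.1) (M.obj U)

/-- Restriction of sections of the symmetric algebra. -/
def symRes {U V : X.AffineZariskiSiteᵒᵖ} (f : U ⟶ V) : M.symAt U →+* M.symAt V :=
  symMap (siteRes f) (M.res f)

lemma symRes_id (U : X.AffineZariskiSiteᵒᵖ) : M.symRes (𝟙 U) = RingHom.id _ := by
  refine sym_ringHom_ext ?_ ?_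
  · intro a
    rw [symRes, symMap_algebraMap, siteRes_id]
    rfl
  · intro m
    rw [symRes, symMap_ι, M.res_id]
    rfl

lemma symRes_comp {U V W : X.AffineZariskiSiteᵒᵖ} (f : U ⟶ V) (g : V ⟶ W) :
    M.symRes (f ≫ g) = (M.symRes g).comp (M.symRes f) := by
  refine sym_ringHom_ext ?_ ?_
  · intro a
    rw [RingHom.comp_apply, symRes, symRes, symRes, symMap_algebraMap, symMap_algebraMap,
      symMap_algebraMap, siteRes_comp]
    rfl
  · intro m
    rw [RingHom.comp_apply, symRes, symRes, symRes, symMap_ι, symMap_ι, symMap_ι, M.res_comp]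

/-- The symmetric algebra of a quasi-coherent module. -/
def sym : GradedAlgebraSheaf X where
  algebra :=
    { obj U := .of (M.symAt U)
      map f := CommRingCat.ofHom (M.symRes f)
      map_id U := CommRingCat.hom_ext (M.symRes_id U)
      map_comp f g := CommRingCat.hom_ext (M.symRes_comp f g) }
  unit :=
    { app U := CommRingCat.ofHom (algebraMap Γ(X, U.unop.1) (M.symAt U))
      naturality U V f := CommRingCat.hom_ext (RingHom.ext fun a =>
        (symMap_algebraMap (siteRes f) (M.res f) a).symm) }
  coequifibered := by
    rw [coequifibered_iff_forall_isLocalizationAway]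
    intro U f
    exact symMap_isLocalization (siteRes (homOfLE (U.basicOpen_le f)).op)
      (M.res (homOfLE (U.basicOpen_le f)).op) f (U.2.isLocalization_basicOpen f)
      (M.exists_eq_res U f) (M.exists_smul_eq U f)
  grading U n := (symGrading Γ(X, U.unop.1) (M.obj U) n).toAddSubgroup
  gradedRing U :=
    { (inferInstance : GradedRing (symGrading Γ(X, U.unop.1) (M.obj U))) with }
  map_mem {U V} f n x hx := symMap_mem (siteRes f) (M.res f) hx
  unit_mem U a := algebraMap_mem_symGrading a

/-- The sections of the direct image of an ideal sheaf. -/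
def pushforwardIdealAt {V : Scheme.{u}} (i : V ⟶ X) [IsAffineHom i] (I : V.IdealSheafData)
    (U : X.AffineZariskiSiteᵒᵖ) : Type u :=
  I.ideal ⟨i ⁻¹ᵁ U.unop.1, U.unop.2.preimage i⟩

section

variable {V : Scheme.{u}} (i : V ⟶ X) [IsAffineHom i] (I : V.IdealSheafData)

instance (U : X.AffineZariskiSiteᵒᵖ) : AddCommGroup (pushforwardIdealAt i I U) :=
  inferInstanceAs (AddCommGroup (I.ideal ⟨i ⁻¹ᵁ U.unop.1, U.unop.2.preimage i⟩))

instance (U : X.AffineZariskiSiteᵒᵖ) : Module Γ(X, U.unop.1) (pushforwardIdealAt i I U) :=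
  Module.compHom (I.ideal ⟨i ⁻¹ᵁ U.unop.1, U.unop.2.preimage i⟩) (i.app U.unop.1).hom

/-- The restriction of sections of `i_* 𝒪_V`. -/
abbrev preimageRes {U W : X.AffineZariskiSiteᵒᵖ} (f : U ⟶ W) :
    Γ(V, i ⁻¹ᵁ U.unop.1) →+* Γ(V, i ⁻¹ᵁ W.unop.1) :=
  (V.presheaf.map (homOfLE (i.preimage_mono (toOpens_mono f.unop.le))).op).hom

lemma preimageRes_app {U W : X.AffineZariskiSiteᵒᵖ} (f : U ⟶ W) (a : Γ(X, U.unop.1)) :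
    preimageRes i f ((i.app U.unop.1).hom a) = (i.app W.unop.1).hom (siteRes f a) :=
  congr($(i.naturality ((toOpensFunctor X).map f.unop).op).hom a).symm

lemma ideal_le_comap_preimageRes {U W : X.AffineZariskiSiteᵒᵖ} (f : U ⟶ W) :
    I.ideal ⟨i ⁻¹ᵁ U.unop.1, U.unop.2.preimage i⟩ ≤
      (I.ideal ⟨i ⁻¹ᵁ W.unop.1, W.unop.2.preimage i⟩).comap (preimageRes i f) := by
  rw [← Ideal.map_le_iff_le_comap]
  exact (I.map_ideal (U := ⟨i ⁻¹ᵁ W.unop.1, W.unop.2.preimage i⟩)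
    (V := ⟨i ⁻¹ᵁ U.unop.1, U.unop.2.preimage i⟩) _).le

/-- Restriction of sections of the direct image of an ideal sheaf. -/
def pushforwardIdealRes {U W : X.AffineZariskiSiteᵒᵖ} (f : U ⟶ W) :
    pushforwardIdealAt i I U →ₛₗ[siteRes f] pushforwardIdealAt i I W where
  toFun := idealRes _ _ (preimageRes i f) (ideal_le_comap_preimageRes i I f)
  map_add' x y := map_add (idealRes _ _ (preimageRes i f) (ideal_le_comap_preimageRes i I f)) x y
  map_smul' a x := by
    refine ((idealRes _ _ (preimageRes i f) (ideal_le_comap_preimageRes i I f)).map_smulₛₗ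
      ((i.app U.unop.1).hom a) x).trans ?_
    rw [preimageRes_app]
    rfl

/-- The direct image `i_* I` of a quasi-coherent ideal sheaf `I` under an affine morphism `i`. -/
def pushforwardIdeal : QCohModule X where
  obj := pushforwardIdealAt i I
  addCommGroup U := inferInstance
  module U := inferInstance
  res f := pushforwardIdealRes i I f
  res_id U x := by
    refine Subtype.ext ?_
    exact congr($(V.presheaf.map_id (.op (i ⁻¹ᵁ U.unop.1))).hom x.1)
  res_comp {U W T} f g x := by
    refine Subtype.ext ?_
    exact congr($(V.presheaf.map_comp (homOfLE (i.preimage_mono (toOpens_mono f.unop.le))).op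
      (homOfLE (i.preimage_mono (toOpens_mono g.unop.le))).op).hom x.1)
  exists_eq_res U f y := by
    obtain ⟨n, x, h⟩ := idealRes_surj _ (preimageRes i (homOfLE (U.basicOpen_le f)).op)
      ((i.app U.1).hom f) ((U.2.preimage i).isLocalization_of_eq_basicOpen _ _
        (i.preimage_basicOpen f)) _
      (I.map_ideal (U := ⟨i ⁻¹ᵁ X.basicOpen f, (U.2.basicOpen f).preimage i⟩)
        (V := ⟨i ⁻¹ᵁ U.1, U.2.preimage i⟩) _)
      (ideal_le_comap_preimageRes i I (homOfLE (U.basicOpen_le f)).op) y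
    refine ⟨n, x, Eq.trans ?_ h⟩
    rw [preimageRes_app, ← map_pow (i.app _).hom]
    rfl
  exists_smul_eq U f x y hxy := by
    obtain ⟨n, h⟩ := idealRes_inj _ (preimageRes i (homOfLE (U.basicOpen_le f)).op)
      ((i.app U.1).hom f) ((U.2.preimage i).isLocalization_of_eq_basicOpen _ _
        (i.preimage_basicOpen f)) _
      (ideal_le_comap_preimageRes i I (homOfLE (U.basicOpen_le f)).op) x y hxy
    refine ⟨n, ?_⟩
    rw [← map_pow] at h
    exact h

end

end QCohModule

end SymSheaf

section Jacobian

/-- The ideal generated by an ideal `I` of a `k`-algebra and by the derivatives `θ h` of the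
elements `h` of `I` along all `k`-derivations `θ`. If `Spec A` is smooth with local coordinates
`x₁, …, xₙ` and `I = (h)`, it is generated by `h` and by the partial derivatives `∂h/∂xᵢ`. -/
def jacobian (k : Type*) {A : Type*} [CommRing k] [CommRing A] [Algebra k A] (I : Ideal A) :
    Ideal A :=
  I ⊔ Ideal.span {a | ∃ (θ : Derivation k A A) (h : A), h ∈ I ∧ θ h = a}

section

variable {k A A' : Type u} [CommRing k] [CommRing A] [CommRing A'] [Algebra k A] [Algebra k A']
  [Algebra A A'] [IsScalarTower k A A']

lemma exists_derivation_extends (f : A) [IsLocalization.Away f A']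
    (θ : Derivation k A A) :
    ∃ θ' : Derivation k A' A', ∀ a, θ' (algebraMap A A' a) = algebraMap A A' (θ a) := by
  let g : Ω[A⁄k] →ₗ[A] A' := (Algebra.linearMap A A') ∘ₗ θ.liftKaehlerDifferential
  let g' : Ω[A'⁄k] →ₗ[A] A' := IsLocalizedModule.lift (.powers f)
    (KaehlerDifferential.map k k A A') g (fun x =>
      IsLocalizedModule.map_units (Algebra.linearMap A A') x)
  let g'' : Ω[A'⁄k] →ₗ[A'] A' := g'.extendScalarsOfIsLocalization (.powers f) A'
  refine ⟨g''.compDer (KaehlerDifferential.D k A'), fun a => ?_⟩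
  change g' (KaehlerDifferential.D k A' (algebraMap A A' a)) = _
  rw [← KaehlerDifferential.map_D k k A A']
  refine (IsLocalizedModule.lift_apply (.powers f) (KaehlerDifferential.map k k A A') g _ _).trans ?_
  simp [g]

lemma exists_derivation_restricts [Algebra.FinitePresentation k A] (f : A)
    [IsLocalization.Away f A'] (θ' : Derivation k A' A') :
    ∃ (n : ℕ) (θ : Derivation k A A), ∀ a, algebraMap A A' (θ a) =
      algebraMap A A' f ^ n * θ' (algebraMap A A' a) := by
  obtain ⟨g, ⟨_, n, rfl⟩, h⟩ := Module.FinitePresentation.exists_lift_of_isLocalizedModule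
    (.powers f) (Algebra.linearMap A A') (θ'.compAlgebraMap A).liftKaehlerDifferential
  refine ⟨n, g.compDer (KaehlerDifferential.D k A), fun a => ?_⟩
  have := congr($h (KaehlerDifferential.D k A a))
  refine this.trans ?_
  change (f ^ n) • (θ'.compAlgebraMap A).liftKaehlerDifferential _ = _
  rw [Derivation.liftKaehlerDifferential_comp_D, Algebra.smul_def, map_pow]
  rfl

lemma map_jacobian [Algebra.FinitePresentation k A] (f : A) [IsLocalization.Away f A']
    (I : Ideal A) :
    (jacobian k I).map (algebraMap A A') = jacobian k (I.map (algebraMap A A')) := by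
  apply le_antisymm
  · rw [jacobian, jacobian, Ideal.map_sup, Ideal.map_span]
    refine sup_le_sup_left (Ideal.span_mono ?_) _
    rintro _ ⟨_, ⟨θ, h, hh, rfl⟩, rfl⟩
    obtain ⟨θ', hθ'⟩ := exists_derivation_extends (A' := A') f θ
    exact ⟨θ', _, Ideal.mem_map_of_mem _ hh, hθ' h⟩
  · have hle : I.map (algebraMap A A') ≤ (jacobian k I).map (algebraMap A A') :=
      Ideal.map_mono le_sup_left
    refine sup_le hle (Ideal.span_le.mpr ?_)
    rintro _ ⟨θ', h', hh', rfl⟩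
    obtain ⟨⟨⟨h, hh⟩, ⟨_, n, rfl⟩⟩, hn⟩ :=
      (IsLocalization.mem_map_algebraMap_iff (.powers f) A').mp hh'
    obtain ⟨m, θ, hθ⟩ := exists_derivation_restricts (A' := A') f θ'
    have h1 : algebraMap A A' (θ h) ∈ (jacobian k I).map (algebraMap A A') :=
      Ideal.mem_map_of_mem _ (le_sup_right (a := I) (Ideal.subset_span ⟨θ, h, hh, rfl⟩))
    have hu : IsUnit (algebraMap A A' f ^ m * algebraMap A A' f ^ n) :=
      ((IsLocalization.Away.algebraMap_isUnit f).pow m).mul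
        ((IsLocalization.Away.algebraMap_isUnit f).pow n)
    refine (Ideal.unit_mul_mem_iff_mem _ hu).mp ?_
    have h2 : algebraMap A A' f ^ m * algebraMap A A' f ^ n * θ' h' = algebraMap A A' (θ h) -
        (algebraMap A A' f ^ m * θ' (algebraMap A A' (f ^ n))) * h' := by
      dsimp only at hn
      rw [hθ, ← hn, Derivation.leibniz, map_pow]
      simp only [smul_eq_mul]
      ring
    rw [h2]
    exact sub_mem h1 (Ideal.mul_mem_left _ _ (hle hh'))

end

lemma scalars_finitePresentation {k : Type u} [CommRing k] {X : Scheme.{u}}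
    (s : X ⟶ Spec (.of k)) [LocallyOfFinitePresentation s] (U : X.affineOpens) :
    (scalars s U.1).FinitePresentation := by
  have h := s.finitePresentation_appLE (isAffineOpen_top _) U.2 le_top
  exact h.comp (RingHom.FinitePresentation.of_bijective
    (ConcreteCategory.bijective_of_isIso (Scheme.ΓSpecIso (.of k)).inv))

/-- The ideal sheaf in `𝒪_X` of the singular subscheme of the hypersurface defined by `D` in a
`k`-scheme `X` (the Jacobian ideal sheaf): locally it is generated by `h` and its partial
derivatives, where `h` is an equation of the hypersurface. -/
def jacobianIdeal {k : Type u} [CommRing k] {X : Scheme.{u}} (s : X ⟶ Spec (.of k))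
    [LocallyOfFinitePresentation s] (D : X.IdealSheafData) : X.IdealSheafData where
  ideal U :=
    letI := (scalars s U.1).toAlgebra
    jacobian k (D.ideal U)
  map_ideal_basicOpen U f := by
    letI := (scalars s U.1).toAlgebra
    letI := (scalars s (X.affineBasicOpen f).1).toAlgebra
    letI : Algebra Γ(X, U.1) Γ(X, (X.affineBasicOpen f).1) :=
      (X.presheaf.map (homOfLE <| X.basicOpen_le f).op).hom.toAlgebra
    haveI : IsScalarTower k Γ(X, U.1) Γ(X, (X.affineBasicOpen f).1) :=
      IsScalarTower.of_algebraMap_eq' (map_scalars s _).symm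
    haveI : IsLocalization.Away f Γ(X, (X.affineBasicOpen f).1) :=
      U.2.isLocalization_basicOpen f
    haveI : Algebra.FinitePresentation k Γ(X, U.1) := scalars_finitePresentation s U
    refine (map_jacobian (A' := Γ(X, (X.affineBasicOpen f).1)) f (D.ideal U)).trans ?_
    exact congrArg (jacobian k) (D.map_ideal_basicOpen U f)

/-- An effective Cartier divisor: a closed subscheme defined locally by one equation which is not
a zero divisor. -/
def IsEffectiveCartier {X : Scheme.{u}} (D : X.IdealSheafData) : Prop :=
  ∀ x : X, ∃ U : X.affineOpens, x ∈ U.1 ∧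
    ∃ h ∈ nonZeroDivisors Γ(X, U.1), D.ideal U = Ideal.span {h}

/-- The inclusion of an ideal `J` as the degree one part of its Rees algebra `⨁ J^n`. -/
def toRees {A : Type*} [CommRing A] (J : Ideal A) : J →ₗ[A] reesAlgebra J where
  toFun x := ⟨Polynomial.monomial 1 x.1, reesAlgebra.monomial_mem.mpr (by simp)⟩
  map_add' x y := Subtype.ext (map_add (Polynomial.monomial 1) x.1 y.1)
  map_smul' a x := Subtype.ext (map_smul (Polynomial.monomial 1) a x.1)

/-- An ideal sheaf `J` is of linear type if the canonical epimorphism from its symmetric algebra to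
its Rees algebra is an isomorphism. -/
def IsLinearType {X : Scheme.{u}} (J : X.IdealSheafData) : Prop :=
  ∀ U : X.affineOpens, Function.Bijective (SymmetricAlgebra.lift (toRees (J.ideal U)))

end Jacobian

end QuasiBlowup

end

/-!
Let `i : Y ⟶ X` be a closed immersion, `J` an ideal sheaf of linear type on `X` which contains the
ideal sheaf `K` of `Y`, and `I = J 𝒪_Y`. The quasi-symmetric blow-up algebra of `I` is a quotient of
`Sym_{𝒪_Y} I`, so `Sym_{𝒪_X} (i_* I)` maps onto its direct image. Over an affine open `U ⊆ X`, an
element of the kernel dies in the blow-up algebra of every ambient scheme of `i⁻¹ U`, in particular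
in that of `U` itself, whose degree `n` part is `Jⁿ / K Jⁿ⁻¹`. As `Sym J = ⨁ Jⁿ`, an element of the
kernel of degree `n > 0` lifts to an element of `K Jⁿ⁻¹`, and products with a factor from `K` vanish
in `Sym (J / K)`. So the homomorphism is bijective in positive degrees, which is all that `Proj`
sees. In degree zero it is `𝒪_X ⟶ i_* 𝒪_Y`.
-/

noncomputable section

namespace QuasiBlowup

section SymmetricAlgebra

variable {R S T M N P : Type*} [CommRing R] [CommRing S] [CommRing T] [AddCommMonoid M]
  [AddCommMonoid N] [AddCommMonoid P] [Module R M] [Module S N] [Module T P]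

lemma symMap_symMap {ρ : R →+* S} {σ : S →+* T} {τ : R →+* T} [RingHomCompTriple ρ σ τ]
    (f : M →ₛₗ[ρ] N) (g : N →ₛₗ[σ] P) (x : SymmetricAlgebra R M) :
    symMap σ g (symMap ρ f x) = symMap τ (g.comp f) x := by
  suffices h : (symMap σ g).comp (symMap ρ f) = symMap τ (g.comp f) from congr($h x)
  apply sym_ringHom_ext <;> simp [RingHomCompTriple.comp_apply]

lemma exists_mem_symGrading_symMap_eq {ρ : R →+* S} (hρ : Function.Surjective ρ)
    {f : M →ₛₗ[ρ] N} (hf : Function.Surjective f) {n : ℕ} {y : SymmetricAlgebra S N}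
    (hy : y ∈ symGrading S N n) : ∃ x ∈ symGrading R M n, symMap ρ f x = y := by
  induction hy using Submodule.pow_induction_on_left' with
  | algebraMap s =>
    obtain ⟨r, rfl⟩ := hρ s
    exact ⟨algebraMap R _ r, algebraMap_mem_symGrading r, symMap_algebraMap ρ f r⟩
  | add _ _ _ _ _ ih₁ ih₂ =>
    obtain ⟨x₁, hx₁, rfl⟩ := ih₁
    obtain ⟨x₂, hx₂, rfl⟩ := ih₂
    exact ⟨x₁ + x₂, add_mem hx₁ hx₂, map_add _ _ _⟩
  | mem_mul _ hm _ _ _ ih =>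
    obtain ⟨n, rfl⟩ := hm
    obtain ⟨m, rfl⟩ := hf n
    obtain ⟨x, hx, rfl⟩ := ih
    refine ⟨SymmetricAlgebra.ι R M m * x, ?_, by rw [map_mul, symMap_ι]⟩
    exact Nat.succ_eq_one_add _ ▸ SetLike.mul_mem_graded (ι_mem_symGrading m) hx

lemma exists_linearMap_comp_eq {L : Type*} [AddCommMonoid L] [Module R L] {ρ : R →+* S}
    {g : M →ₛₗ[ρ] N} (hg : Function.Bijective g) (f : L →ₛₗ[ρ] N) :
    ∃ q : L →ₗ[R] M, g.comp q = f := by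
  have hinv (x : N) : g (Function.surjInv hg.2 x) = x := Function.surjInv_eq hg.2 x
  exact ⟨{ toFun := Function.surjInv hg.2 ∘ f
           map_add' _ _ := hg.1 (by simp [hinv])
           map_smul' _ _ := hg.1 (by simp [hinv]) }, LinearMap.ext fun _ => hinv _⟩

end SymmetricAlgebra

section LinearType

open Polynomial

variable {R : Type*} [CommRing R] (J : Ideal R)

lemma exists_lift_toRees_eq_monomial {n : ℕ} {y : SymmetricAlgebra R J}
    (hy : y ∈ symGrading R J n) : ∃ r, (SymmetricAlgebra.lift (toRees J) y).1 = monomial n r := by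
  induction hy using Submodule.pow_induction_on_left' with
  | algebraMap r => exact ⟨r, congrArg Subtype.val (AlgHom.commutes _ r)⟩
  | add _ _ _ _ _ ih₁ ih₂ =>
    obtain ⟨r, hr⟩ := ih₁
    obtain ⟨s, hs⟩ := ih₂
    exact ⟨r + s, by rw [map_add, Subalgebra.coe_add, hr, hs, map_add]⟩
  | mem_mul _ hm n _ _ ih =>
    obtain ⟨a, rfl⟩ := hm
    obtain ⟨r, hr⟩ := ih
    refine ⟨a * r, ?_⟩
    rw [map_mul, Subalgebra.coe_mul, hr, SymmetricAlgebra.lift_ι_apply, Nat.succ_eq_one_add]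
    exact monomial_mul_monomial 1 n a.1 r

lemma lift_toRees_surjective : Function.Surjective (SymmetricAlgebra.lift (toRees J)) := by
  suffices h : reesAlgebra J ≤
      ((reesAlgebra J).val.comp (SymmetricAlgebra.lift (toRees J))).range by
    intro p
    obtain ⟨y, hy⟩ := h p.2
    exact ⟨y, Subtype.ext hy⟩
  refine (adjoin_monomial_eq_reesAlgebra J).ge.trans (Algebra.adjoin_le ?_)
  rintro _ ⟨r, hr, rfl⟩
  exact ⟨SymmetricAlgebra.ι R J ⟨r, hr⟩,
    congrArg Subtype.val (SymmetricAlgebra.lift_ι_apply (toRees J) ⟨r, hr⟩)⟩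

variable {J}

lemma exists_symMap_eq_zero_lift_toRees_eq_monomial {M : Type*} [AddCommMonoid M] [Module R M]
    {K : Ideal R} (hKJ : K ≤ J) {q : J →ₗ[R] M} (hq : ∀ a (ha : a ∈ K), q ⟨a, hKJ ha⟩ = 0)
    {n : ℕ} {r : R} (hr : r ∈ K * J ^ n) :
    ∃ z, symMap (RingHom.id R) q z = 0 ∧
      (SymmetricAlgebra.lift (toRees J) z).1 = monomial (n + 1) r := by
  induction hr using Submodule.mul_induction_on' with
  | mem_mul_mem a ha b hb =>
    obtain ⟨z, hz⟩ := lift_toRees_surjective J ⟨monomial n b, reesAlgebra.monomial_mem.mpr hb⟩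
    refine ⟨SymmetricAlgebra.ι R J ⟨a, hKJ ha⟩ * z, ?_, ?_⟩
    · rw [map_mul, symMap_ι, hq a ha, map_zero, zero_mul]
    · rw [map_mul, hz, SymmetricAlgebra.lift_ι_apply, add_comm]
      exact monomial_mul_monomial 1 n a b
  | add _ _ _ _ ih₁ ih₂ =>
    obtain ⟨z₁, hz₁, h₁⟩ := ih₁
    obtain ⟨z₂, hz₂, h₂⟩ := ih₂
    exact ⟨z₁ + z₂, by rw [map_add, hz₁, hz₂, add_zero],
      by rw [map_add, Subalgebra.coe_add, h₁, h₂, map_add]⟩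

end LinearType

section Blowup

open Polynomial

variable {R A : Type*} [CommRing R] [CommRing A] {π : R →+* A} (hπ : Function.Surjective π)
  (I : Ideal A)

lemma toBlowup_symMap_idealRes (y : SymmetricAlgebra R (I.comap π)) :
    toBlowup π hπ I (symMap π (idealRes (I.comap π) I π le_rfl) y) =
      BlowupAlgebra.mk π I (SymmetricAlgebra.lift (toRees (I.comap π)) y) := by
  suffices h : (toBlowup π hπ I).comp (symMap π (idealRes (I.comap π) I π le_rfl)) =
      (BlowupAlgebra.mk π I).comp (SymmetricAlgebra.lift (toRees (I.comap π))).toRingHom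
    from congr($h y)
  apply sym_ringHom_ext
  · intro r
    rw [RingHom.comp_apply, symMap_algebraMap, toBlowup_algebraMap]
    exact congrArg (BlowupAlgebra.mk π I) (AlgHom.commutes _ r).symm
  · rintro ⟨r, hr⟩
    rw [RingHom.comp_apply, symMap_ι]
    refine (toBlowup_ι π hπ I r hr).trans ?_
    exact congrArg (BlowupAlgebra.mk π I)
      (SymmetricAlgebra.lift_ι_apply (toRees (I.comap π)) ⟨r, hr⟩).symm

variable {I} {M : Type*} [AddCommGroup M] [Module R M]

lemma eq_zero_of_toBlowup_symMap_eq_zero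
    (hlin : Function.Injective (SymmetricAlgebra.lift (toRees (I.comap π))))
    {g : M →ₛₗ[π] I} (hg : Function.Bijective g) {n : ℕ} (hn : 0 < n) {x : SymmetricAlgebra R M}
    (hx : x ∈ symGrading R M n) (h₀ : toBlowup π hπ I (symMap π g x) = 0) : x = 0 := by
  obtain ⟨q, hq⟩ := exists_linearMap_comp_eq hg (idealRes (I.comap π) I π le_rfl)
  have hgq (j) : g (q j) = idealRes (I.comap π) I π le_rfl j := congr($hq j)
  have hq_surj : Function.Surjective q := fun m => by
    obtain ⟨r, hr⟩ := hπ (g m).1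
    exact ⟨⟨r, Ideal.mem_comap.mpr (hr ▸ (g m).2)⟩, hg.1 ((hgq _).trans (Subtype.ext hr))⟩
  obtain ⟨y, hy, rfl⟩ := exists_mem_symGrading_symMap_eq Function.surjective_id hq_surj hx
  rw [symMap_symMap, hq, toBlowup_symMap_idealRes, BlowupAlgebra.mk_eq_zero] at h₀
  obtain ⟨r, hyr⟩ := exists_lift_toRees_eq_monomial _ hy
  have hr : r ∈ RingHom.ker π * I.comap π ^ (n - 1) := by
    simpa only [hyr, coeff_monomial_same] using h₀ n
  have hKI : RingHom.ker π ≤ I.comap π := Ideal.comap_mono bot_le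
  have hqK (a : R) (ha : a ∈ RingHom.ker π) : q ⟨a, hKI ha⟩ = 0 :=
    hg.1 (by rw [hgq, map_zero]; exact Subtype.ext ha)
  obtain ⟨z, hz, hzr⟩ := exists_symMap_eq_zero_lift_toRees_eq_monomial hKI hqK hr
  rw [Nat.sub_add_cancel hn] at hzr
  rw [hlin (Subtype.ext (hyr.trans hzr.symm)), hz]

end Blowup

section ProjMap

open HomogeneousLocalization

variable {S S' σ τ : Type u} [CommRing S] [CommRing S'] [SetLike σ S] [AddSubgroupClass σ S]
  [SetLike τ S'] [AddSubgroupClass τ S'] {𝒜 : ℕ → σ} [GradedRing 𝒜] {ℬ : ℕ → τ} [GradedRing ℬ]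
  {φ : 𝒜 →+*ᵍ ℬ}

lemma irrelevant_le_map_of_surjOn (h : ∀ n, 0 < n → Set.SurjOn φ (𝒜 n) (ℬ n)) :
    HomogeneousIdeal.irrelevant ℬ ≤ (HomogeneousIdeal.irrelevant 𝒜).map φ := by
  rw [← toIdeal_le_toIdeal_iff, HomogeneousIdeal.toIdeal_irrelevant_le]
  intro n hn b hb
  obtain ⟨a, ha, rfl⟩ := h n hn hb
  exact Ideal.mem_map_of_mem _ (HomogeneousIdeal.mem_irrelevant_of_mem 𝒜 hn ha)

lemma away_mk_eq_zero_iff {m : ℕ} {s : S} (hs : s ∈ 𝒜 m) {n : ℕ} {a : S} (ha : a ∈ 𝒜 (n • m)) :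
    Away.mk 𝒜 hs n a ha = 0 ↔ ∃ k, s ^ k * a = 0 := by
  rw [← val_injective _ |>.eq_iff, Away.val_mk, val_zero, Localization.mk_eq_mk',
    IsLocalization.mk'_eq_zero_iff]
  simp [Submonoid.mem_powers_iff]

variable {m : ℕ} {s : S}

lemma awayMap_injective (h : ∀ n, 0 < n → Set.InjOn φ (𝒜 n)) (hm : 0 < m) (hs : s ∈ 𝒜 m) :
    Function.Injective (Away.map φ s) := by
  rw [injective_iff_map_eq_zero]
  intro z hz
  obtain ⟨n, a, ha, rfl⟩ := Away.mk_surjective 𝒜 hs z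
  rw [Away.map_mk, away_mk_eq_zero_iff] at hz
  obtain ⟨k, hk⟩ := hz
  rw [away_mk_eq_zero_iff]
  -- The extra factor `s` makes the degree of `s ^ (k + 1) * a` positive.
  have hmem : s ^ (k + 1) * a ∈ 𝒜 ((k + 1) • m + n • m) :=
    SetLike.mul_mem_graded (SetLike.pow_mem_graded _ hs) ha
  refine ⟨k + 1, h _ (by positivity) hmem (zero_mem _) ?_⟩
  rw [map_mul, map_pow, pow_succ', mul_assoc, hk, mul_zero, map_zero]

lemma awayMap_surjective (h : ∀ n, 0 < n → Set.SurjOn φ (𝒜 n) (ℬ n)) (hm : 0 < m)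
    (hs : s ∈ 𝒜 m) : Function.Surjective (Away.map φ s) := by
  intro z
  obtain ⟨n, b, hb, rfl⟩ := Away.mk_surjective ℬ (φ.map_mem hs) z
  have hb' : φ s * b ∈ ℬ ((n + 1) • m) := by
    rw [succ_nsmul']
    exact SetLike.mul_mem_graded (φ.map_mem hs) hb
  obtain ⟨a, ha, hab⟩ := h _ (by positivity) hb'
  refine ⟨Away.mk 𝒜 hs (n + 1) a ha, val_injective _ ?_⟩
  rw [Away.map_mk, Away.val_mk, Away.val_mk, Localization.mk_eq_mk_iff, Localization.r_iff_exists]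
  refine ⟨1, ?_⟩
  simp only [OneMemClass.coe_one, GradedRingHom.coe_toRingHom, hab, one_mul]
  ring

lemma isPullback_awayι_projMap
    (hφ : HomogeneousIdeal.irrelevant ℬ ≤ (HomogeneousIdeal.irrelevant 𝒜).map φ)
    (hm : 0 < m) (hs : s ∈ 𝒜 m) :
    IsPullback (Spec.map (CommRingCat.ofHom (Away.map φ s)))
      (Proj.awayι ℬ (φ s) (φ.map_mem hs) hm) (Proj.awayι 𝒜 s hs hm) (Proj.map φ hφ) := by
  refine IsOpenImmersion.isPullback _ _ _ _ (Proj.awayι_comp_map φ hφ hm s hs) ?_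
  rw [Proj.opensRange_awayι, Proj.opensRange_awayι, Proj.map_preimage_basicOpen]

lemma isIso_projMap (h : ∀ n, 0 < n → Set.BijOn φ (𝒜 n) (ℬ n))
    (hφ : HomogeneousIdeal.irrelevant ℬ ≤ (HomogeneousIdeal.irrelevant 𝒜).map φ) :
    IsIso (Proj.map φ hφ) := by
  refine IsZariskiLocalAtTarget.of_openCover (P := MorphismProperty.isomorphisms Scheme)
    (𝒰 := (Proj.affineOpenCover 𝒜).openCover) ?_
  rintro ⟨⟨m, hm⟩, ⟨s, hs : s ∈ 𝒜 m⟩⟩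
  have : IsIso (CommRingCat.ofHom (Away.map φ s)) :=
    (ConcreteCategory.isIso_iff_bijective _).mpr
      ⟨awayMap_injective (fun n hn => (h n hn).injOn) hm hs,
        awayMap_surjective (fun n hn => (h n hn).surjOn) hm hs⟩
  change IsIso (pullback.snd (Proj.map φ hφ) (Proj.awayι 𝒜 s hs hm))
  rw [← (isPullback_awayι_projMap hφ hm hs).flip.isoPullback_inv_snd]
  infer_instance

variable {A A' : Type u} [CommRing A] [CommRing A']

lemma projMap_projToSpec {ρ : A →+* A'} {α : A →+* S} {α' : A' →+* S'}
    (hα : ∀ a, α a ∈ 𝒜 0) (hα' : ∀ a, α' a ∈ ℬ 0) (comm : ∀ a, φ (α a) = α' (ρ a))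
    (hφ : HomogeneousIdeal.irrelevant ℬ ≤ (HomogeneousIdeal.irrelevant 𝒜).map φ) :
    Proj.map φ hφ ≫ projToSpec 𝒜 α hα =
      projToSpec ℬ α' hα' ≫ Spec.map (CommRingCat.ofHom ρ) := by
  refine (Proj.mapAffineOpenCover φ hφ).openCover.hom_ext _ _ ?_
  rintro ⟨⟨m, hm⟩, ⟨s, hs : s ∈ 𝒜 m⟩⟩
  change Proj.awayι ℬ (φ s) (φ.map_mem hs) hm ≫ _ = Proj.awayι ℬ (φ s) (φ.map_mem hs) hm ≫ _
  rw [Proj.awayι_comp_map_assoc φ hφ hm s hs, awayι_projToSpec, reassoc_of% awayι_projToSpec,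
    ← Spec.map_comp, ← Spec.map_comp]
  exact congrArg Spec.map (CommRingCat.hom_ext (RingHom.ext
    (awayMap_awayConst φ ρ α α' hα hα' comm s hs)))

end ProjMap

section RelativeGluing

open Scheme.Cover

variable {X : Scheme.{u}} {𝒰 : X.OpenCover} [Category 𝒰.I₀] [𝒰.LocallyDirected]
  [Small.{u} 𝒰.I₀] [Quiver.IsThin 𝒰.I₀] (d : RelativeGluingData 𝒰)

lemma isPullback_toBase_colimitDesc (c : Cocone d.functor) (p : c.pt ⟶ X)
    (h : ∀ a, IsPullback (d.natTrans.app a) (c.ι.app a) (𝒰.f a) p) :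
    IsPullback d.toBase (colimit.desc d.functor c) (𝟙 X) p := by
  refine Scheme.isPullback_of_openCover _ _ _ _ 𝒰 fun a => ?_
  have hd := (d.isPullback_natTrans_ι_toBase a).flip
  refine (h a).of_iso hd.isoPullback (.refl _) (.refl _) (.refl _) ?_ ?_ ?_ ?_
  · exact (Category.comp_id _).trans hd.isoPullback_hom_snd.symm
  · have := hd.isoPullback_hom_fst_assoc (colimit.desc d.functor c)
    rw [colimit.ι_desc] at this
    exact (Category.comp_id _).trans this.symm
  · exact (congrArg (· ≫ _) (Category.comp_id (𝒰.f a))).trans (Category.id_comp _).symm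
  · simp

/-- Schemes glued along an open cover of `X` are determined over `X` by their local pieces: a
compatible family of identifications of the local pieces of `d` with the preimages under `p` of the
members of the cover identifies the glued scheme with the source of `p`. -/
def overGluedIso (c : Cocone d.functor) (p : c.pt ⟶ X)
    (h : ∀ a, IsPullback (d.natTrans.app a) (c.ι.app a) (𝒰.f a) p) :
    Over.mk d.toBase ≅ Over.mk p :=
  have hd := isPullback_toBase_colimitDesc d c p h
  have := hd.isIso_snd_of_isIso
  Over.isoMk (asIso (colimit.desc d.functor c)) (by simpa using hd.w.symm)

/-- Let the preimages under `i : Y ⟶ X` of the members of a cover of `X` be members of a cover of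
`Y`. Relative gluing data on `X` and on `Y` whose local pieces are compatibly isomorphic glue to
isomorphic schemes over `X`. -/
def overGluedIsoComp {Y : Scheme.{u}} {𝒱 : Y.OpenCover} [Category 𝒱.I₀] [𝒱.LocallyDirected]
    [Small.{u} 𝒱.I₀] [Quiver.IsThin 𝒱.I₀] (d' : RelativeGluingData 𝒱) (i : Y ⟶ X)
    (F : 𝒰.I₀ ⥤ 𝒱.I₀) (j : ∀ a, 𝒱.X (F.obj a) ⟶ 𝒰.X a)
    (hj : ∀ a, IsPullback (j a) (𝒱.f (F.obj a)) (𝒰.f a) i) (e : F ⋙ d'.functor ≅ d.functor)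
    (he : ∀ a, e.hom.app a ≫ d.natTrans.app a = d'.natTrans.app (F.obj a) ≫ j a) :
    Over.mk d.toBase ≅ Over.mk (d'.toBase ≫ i) :=
  overGluedIso d ((Cocone.precompose e.inv).obj ((colimit.cocone d'.functor).whisker F))
    (d'.toBase ≫ i) fun a => by
      have h := (d'.isPullback_natTrans_ι_toBase (F.obj a)).flip.paste_vert (hj a).flip
      refine h.flip.of_iso (e.app a) (.refl _) (.refl _) (.refl _) ?_ ?_ ?_ ?_
      · exact (Category.comp_id _).trans (he a).symm
      · simp
      · exact (Category.comp_id _).trans (Category.id_comp _).symm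
      · simp

end RelativeGluing

section AffineMorphism

open Scheme Scheme.AffineZariskiSite Opposite

variable {X Y : Scheme.{u}} (i : Y ⟶ X)

lemma specMap_app_isoSpec_inv {U : X.Opens} (hU : IsAffineOpen U)
    (hV : IsAffineOpen (i ⁻¹ᵁ U)) :
    Spec.map (i.app U) ≫ hU.isoSpec.inv = hV.isoSpec.inv ≫ i ∣_ U := by
  rw [← cancel_mono U.ι, Category.assoc, Category.assoc, morphismRestrict_ι]
  have h := hU.SpecMap_appLE_fromSpec i hV le_rfl
  rw [Scheme.Hom.appLE_eq_app] at h
  exact h.trans (Category.assoc ..)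

variable [IsAffineHom i]

/-- The preimages of the affine open subschemes under an affine morphism, as a functor. -/
def preimageSite : X.AffineZariskiSite ⥤ Y.AffineZariskiSite :=
  Monotone.functor (f := fun U => ⟨i ⁻¹ᵁ U.1, U.2.preimage i⟩) <| by
    rintro V U ⟨f, hf⟩
    exact ⟨(i.app U.1).hom f, (i.preimage_basicOpen f).symm.trans (congrArg (i ⁻¹ᵁ ·) hf)⟩

namespace GradedAlgebraSheaf

/-- A homomorphism of graded algebras from `S` on `X` to the direct image of `T` under an affine
morphism `i : Y ⟶ X`, given by its components over the affine open subschemes of `X`. -/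
structure PushforwardHom (S : GradedAlgebraSheaf X) (T : GradedAlgebraSheaf Y) where
  hom (U : X.AffineZariskiSite) : S.grading (.op U) →+*ᵍ T.grading (.op ((preimageSite i).obj U))
  hom_unit (U : X.AffineZariskiSite) (a : Γ(X, U.1)) :
    hom U ((S.unit.app (.op U)).hom a) =
      (T.unit.app (.op ((preimageSite i).obj U))).hom ((i.app U.1).hom a)
  hom_res {V U : X.AffineZariskiSite} (f : V ⟶ U) (x : S.algebra.obj (.op U)) :
    hom V (S.res f.op x) = T.res ((preimageSite i).map f).op (hom U x)

namespace PushforwardHom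

variable {i} {S : GradedAlgebraSheaf X} {T : GradedAlgebraSheaf Y} (ψ : PushforwardHom i S T)

lemma projMap_projLocal (U : X.AffineZariskiSite)
    (hU : HomogeneousIdeal.irrelevant (T.grading (.op ((preimageSite i).obj U))) ≤
      (HomogeneousIdeal.irrelevant (S.grading (.op U))).map (ψ.hom U)) :
    Proj.map (ψ.hom U) hU ≫ S.projLocal U = T.projLocal ((preimageSite i).obj U) ≫ i ∣_ U.1 := by
  have h := projMap_projToSpec (S.unit_mem _) (T.unit_mem _) (ψ.hom_unit U) hU
  calc Proj.map (ψ.hom U) hU ≫ S.projLocal U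
    _ = projToSpec _ _ (T.unit_mem (.op ((preimageSite i).obj U))) ≫
          Spec.map (i.app U.1) ≫ U.2.isoSpec.inv := (reassoc_of% h) _
    _ = projToSpec _ _ (T.unit_mem (.op ((preimageSite i).obj U))) ≫
          (U.2.preimage i).isoSpec.inv ≫ i ∣_ U.1 :=
        congrArg (_ ≫ ·) (specMap_app_isoSpec_inv i U.2 (U.2.preimage i))
    _ = T.projLocal ((preimageSite i).obj U) ≫ i ∣_ U.1 := (Category.assoc ..).symm

lemma projMap_res_comp {V U : X.AffineZariskiSite} (f : V ⟶ U)
    (hV : HomogeneousIdeal.irrelevant (T.grading (.op ((preimageSite i).obj V))) ≤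
      (HomogeneousIdeal.irrelevant (S.grading (.op V))).map (ψ.hom V))
    (hU : HomogeneousIdeal.irrelevant (T.grading (.op ((preimageSite i).obj U))) ≤
      (HomogeneousIdeal.irrelevant (S.grading (.op U))).map (ψ.hom U)) :
    Proj.map (T.res ((preimageSite i).map f).op) (T.irrelevant_le _) ≫ Proj.map (ψ.hom U) hU =
      Proj.map (ψ.hom V) hV ≫ Proj.map (S.res f.op) (S.irrelevant_le f.op) := by
  have hres : (T.res ((preimageSite i).map f).op).comp (ψ.hom U) = (ψ.hom V).comp (S.res f.op) :=
    GradedRingHom.ext fun x => (ψ.hom_res f x).symm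
  rw [← Proj.map_comp, ← Proj.map_comp]
  congr 1

/-- The identification of relative homogeneous spectra induced by a homomorphism which is bijective
in positive degrees. -/
def overRelativeProjIso
    (h : ∀ U n, 0 < n → Set.BijOn (ψ.hom U) (S.grading (.op U) n)
      (T.grading (.op ((preimageSite i).obj U)) n)) :
    Over.mk S.relativeProjToBase ≅ Over.mk (T.relativeProjToBase ≫ i) :=
  have hirr (U) := irrelevant_le_map_of_surjOn fun n hn => (h U n hn).surjOn
  have hiso (U) : IsIso (Proj.map (ψ.hom U) (hirr U)) := isIso_projMap (h U) (hirr U)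
  overGluedIsoComp S.projGluingData T.projGluingData i (preimageSite i) (fun U => i ∣_ U.1)
    (fun U => isPullback_morphismRestrict i U.1)
    (NatIso.ofComponents (fun U => @asIso _ _ _ _ (Proj.map (ψ.hom U) (hirr U)) (hiso U))
      fun f => ψ.projMap_res_comp f (hirr _) (hirr _))
    (fun U => ψ.projMap_projLocal U (hirr U))

end PushforwardHom

end GradedAlgebraSheaf

end AffineMorphism

section IdealSheaf

open Scheme

variable {X Y : Scheme.{u}}

lemma map_comap_of_ker_le (i : Y ⟶ X) [IsClosedImmersion i] {J : X.IdealSheafData}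
    (h : i.ker ≤ J) : (J.comap i).map i = J := by
  let l := IsClosedImmersion.lift i J.subschemeι (h.trans_eq J.ker_subschemeι.symm)
  have hJ : l.ker.map i = J := by
    rw [IdealSheafData.map_ker, IsClosedImmersion.lift_fac, IdealSheafData.ker_subschemeι]
  rw [← hJ]
  exact (IdealSheafData.map_gc i).u_l_u_eq_u _

lemma comap_ideal_comap (i : Y ⟶ X) [IsClosedImmersion i] {J : X.IdealSheafData}
    (h : i.ker ≤ J) (U : X.affineOpens) :
    ((J.comap i).ideal ⟨i ⁻¹ᵁ U.1, U.2.preimage i⟩).comap (i.app U.1).hom = J.ideal U := by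
  rw [← IdealSheafData.ideal_map_of_isAffineHom, map_comap_of_ker_le i h]

lemma le_jacobianIdeal {k : Type u} [CommRing k] (s : X ⟶ Spec (.of k))
    [LocallyOfFinitePresentation s] (D : X.IdealSheafData) : D ≤ jacobianIdeal s D :=
  fun _ => le_sup_left

end IdealSheaf

section SymToQuasiSym

open Scheme Scheme.AffineZariskiSite Opposite QCohModule

variable {k : Type u} [CommRing k] {X Y : Scheme.{u}} (i : Y ⟶ X)

lemma app_comp_scalars (s : X ⟶ Spec (.of k)) (U : X.Opens) :
    (i.app U).hom.comp (scalars s U) = scalars (i ≫ s) (i ⁻¹ᵁ U) := by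
  rw [scalars, scalars, ← CommRingCat.hom_comp]
  simp only [Scheme.Hom.comp_appTop, Category.assoc, i.naturality]
  rfl

section AffineMorphism

variable [IsAffineHom i] (I : Y.IdealSheafData)

/-- The identification of the sections of the direct image of `I` over `U` with the sections of
`I` over the preimage of `U`; it is the identity, but semilinear over `𝒪_X(U) → 𝒪_Y(i⁻¹ U)`. -/
def pushforwardIdealSections (U : X.AffineZariskiSite) :
    (pushforwardIdeal i I).obj (.op U) →ₛₗ[(i.app U.1).hom]
      I.ideal ⟨i ⁻¹ᵁ U.1, U.2.preimage i⟩ where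
  toFun x := x
  map_add' _ _ := rfl
  map_smul' _ _ := rfl

lemma pushforwardIdealSections_bijective (U : X.AffineZariskiSite) :
    Function.Bijective (pushforwardIdealSections i I U) := Function.bijective_id

lemma symMap_pushforwardIdealSections_symRes {V U : X.AffineZariskiSite} (f : V ⟶ U)
    (x : (pushforwardIdeal i I).symAt (.op U)) :
    symMap (i.app V.1).hom (pushforwardIdealSections i I V)
        ((pushforwardIdeal i I).symRes f.op x) =
      symMap (preimageRes i f.op)
        (idealRes _ _ (preimageRes i f.op) (ideal_le_comap_preimageRes i I f.op))
        (symMap (i.app U.1).hom (pushforwardIdealSections i I U) x) := by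
  have : RingHomCompTriple (siteRes f.op) (i.app V.1).hom
    ((i.app V.1).hom.comp (siteRes f.op)) := ⟨rfl⟩
  have : RingHomCompTriple (i.app U.1).hom (preimageRes i f.op)
    ((i.app V.1).hom.comp (siteRes f.op)) := ⟨RingHom.ext (preimageRes_app i f.op)⟩
  exact (symMap_symMap _ _ x).trans (symMap_symMap (pushforwardIdealSections i I U)
    (idealRes _ _ (preimageRes i f.op) (ideal_le_comap_preimageRes i I f.op)) x).symm

/-- The component over `U` of the canonical homomorphism `symToQuasiSym`. -/
def symToQuasiSymAt (s : Y ⟶ Spec (.of k)) (U : X.AffineZariskiSite) :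
    (pushforwardIdeal i I).symAt (.op U) →+*
      QuasiSym (A := Γ(Y, i ⁻¹ᵁ U.1)) (scalars s _) (I.ideal ⟨i ⁻¹ᵁ U.1, U.2.preimage i⟩) :=
  (QuasiSym.mk _ _).comp (symMap (i.app U.1).hom (pushforwardIdealSections i I U))

/-- The canonical homomorphism from the symmetric algebra of `i_* I` to the direct image of the
quasi-symmetric blow-up algebra of `I`. -/
def symToQuasiSym (s : Y ⟶ Spec (.of k)) :
    GradedAlgebraSheaf.PushforwardHom i (pushforwardIdeal i I).sym (quasiSymSheaf s I) where
  hom U :=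
    { toRingHom := symToQuasiSymAt i I s U
      map_mem hx := ⟨_, symMap_mem _ _ hx, rfl⟩ }
  hom_unit U a := congrArg (QuasiSym.mk (A := Γ(Y, i ⁻¹ᵁ U.1)) (scalars s _)
    (I.ideal ⟨i ⁻¹ᵁ U.1, U.2.preimage i⟩)) (symMap_algebraMap _ _ a)
  hom_res {V _} f x := congrArg (QuasiSym.mk (A := Γ(Y, i ⁻¹ᵁ V.1)) (scalars s _)
    (I.ideal ⟨i ⁻¹ᵁ V.1, V.2.preimage i⟩)) (symMap_pushforwardIdealSections_symRes i I f x)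

variable {i}

lemma symToQuasiSym_surjOn {I : Y.IdealSheafData} (s : Y ⟶ Spec (.of k)) {U : X.AffineZariskiSite}
    (hi : Function.Surjective (i.app U.1).hom) (n : ℕ) :
    Set.SurjOn ((symToQuasiSym i I s).hom U) ((pushforwardIdeal i I).sym.grading (.op U) n)
      ((quasiSymSheaf s I).grading (.op ((preimageSite i).obj U)) n) := by
  rintro _ ⟨y, hy, rfl⟩
  obtain ⟨x, hx, rfl⟩ :=
    exists_mem_symGrading_symMap_eq hi (pushforwardIdealSections_bijective i I U).2 hy
  exact ⟨x, hx, rfl⟩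

end AffineMorphism

variable {i} [IsClosedImmersion i] (s : X ⟶ Spec (.of k)) {J : X.IdealSheafData}

/-- The affine open `U ⊆ X` as an ambient scheme of `i⁻¹ U`. -/
def closedImmersionAmbient (i : Y ⟶ X) [IsClosedImmersion i] (U : X.AffineZariskiSite) :
    Ambient (A := Γ(Y, i ⁻¹ᵁ U.1)) (scalars (i ≫ s) (i ⁻¹ᵁ U.1)) where
  ring := Γ(X, U.1)
  str := scalars s U.1
  proj := (i.app U.1).hom
  surjective := i.app_surjective U.1 U.2
  comm := app_comp_scalars i s U.1

lemma eq_zero_of_symToQuasiSym_eq_zero (hJ : i.ker ≤ J) (hlin : IsLinearType J)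
    {U : X.AffineZariskiSite} {n : ℕ} (hn : 0 < n)
    {x : (pushforwardIdeal i (J.comap i)).sym.algebra.obj (.op U)}
    (hx : x ∈ (pushforwardIdeal i (J.comap i)).sym.grading (.op U) n)
    (h₀ : (symToQuasiSym i (J.comap i) (i ≫ s)).hom U x = 0) : x = 0 := by
  have hU := (mem_quasiSymIdeal _ _).mp ((QuasiSym.mk_eq_zero _ _).mp h₀)
    (closedImmersionAmbient s i U)
  refine eq_zero_of_toBlowup_symMap_eq_zero (i.app_surjective U.1 U.2) ?_
    (pushforwardIdealSections_bijective i (J.comap i) U) hn hx hU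
  rw [comap_ideal_comap i hJ U]
  exact (hlin U).1

lemma symToQuasiSym_bijOn (hJ : i.ker ≤ J) (hlin : IsLinearType J) (U : X.AffineZariskiSite)
    {n : ℕ} (hn : 0 < n) :
    Set.BijOn ((symToQuasiSym i (J.comap i) (i ≫ s)).hom U)
      ((pushforwardIdeal i (J.comap i)).sym.grading (.op U) n)
      ((quasiSymSheaf (i ≫ s) (J.comap i)).grading (.op ((preimageSite i).obj U)) n) := by
  refine ⟨fun _ => GradedRingHom.map_mem _, fun x hx y hy h => ?_,
    symToQuasiSym_surjOn _ (i.app_surjective U.1 U.2) n⟩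
  rw [← sub_eq_zero]
  exact eq_zero_of_symToQuasiSym_eq_zero s hJ hlin hn (sub_mem hx hy)
    (by rw [map_sub, sub_eq_zero]; exact h)

end SymToQuasiSym

end QuasiBlowup

end

theorem mainTheorem4_general {k : Type u} [CommRing k] {X Y : Scheme.{u}} (i : Y ⟶ X)
    [IsClosedImmersion i] (s : X ⟶ Spec (.of k)) (J : X.IdealSheafData) (hJ : i.ker ≤ J)
    (hlin : QuasiBlowup.IsLinearType J) :
    Nonempty
      (Over.mk (QuasiBlowup.QCohModule.pushforwardIdeal i (J.comap i)).sym.relativeProjToBase ≅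
        Over.mk (QuasiBlowup.quasiBlowupToBase (i ≫ s) (J.comap i) ≫ i)) :=
  ⟨(QuasiBlowup.symToQuasiSym i (J.comap i) (i ≫ s)).overRelativeProjIso fun U _ hn =>
    QuasiBlowup.symToQuasiSym_bijOn s hJ hlin U hn⟩

theorem mainTheorem4 (k : Type u) [Field k] [IsAlgClosed k] [CharZero k]
    (X : Scheme.{u}) (s : X ⟶ Spec (.of k)) [IsIntegral X] [IsSeparated s] [QuasiCompact s]
    [LocallyOfFiniteType s] [Smooth s]
    (D : X.IdealSheafData) (hD : QuasiBlowup.IsEffectiveCartier D) [IsReduced D.subscheme]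
    (hlin : QuasiBlowup.IsLinearType (QuasiBlowup.jacobianIdeal s D)) :
    Nonempty
      (Over.mk (QuasiBlowup.QCohModule.pushforwardIdeal D.subschemeι
          ((QuasiBlowup.jacobianIdeal s D).comap D.subschemeι)).sym.relativeProjToBase ≅
        Over.mk (QuasiBlowup.quasiBlowupToBase (D.subschemeι ≫ s)
          ((QuasiBlowup.jacobianIdeal s D).comap D.subschemeι) ≫ D.subschemeι)) :=
  mainTheorem4_general D.subschemeι s _
    (D.ker_subschemeι.trans_le (QuasiBlowup.le_jacobianIdeal s D)) hlin
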